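/- Let $k$ be a commutative ring; DG categories and DG functors are over $k$. For a DG category $\mathcal A$, let $H^0(\mathcal A)$ be its homotopy category, and let $\mathrm{Perf}(\mathcal A)$ be the DG category of those semi-free right DG $\mathcal A$-modules that are, up to homotopy, direct summands of finitely generated semi-free ones; $h:\mathcal A\to\mathrm{Perf}(\mathcal A)$ is the Yoneda embedding. $\mathcal A$ is pretriangulated if, up to homotopy equivalence, it has a zero object, all shifts, and cones of all closed morphisms of degree $0$. An enhancement of a triangulated category $\mathcal T$ is a pretriangulated DG category $\mathcal A$ together with an equivalence of triangulated categories $\epsilon: H^0(\mathcal A)\to\mathcal T$. For a monad $M$, $M\text{-}\mathrm{Mod}$ is its Eilenberg–Moore category, with the free module functor $F_M$ and the forgetful functor $G_M$. Let $\mathcal C$ be a triangulated category and $(M,\mu,\eta)$ a monad on $\mathcal C$ whose underlying functor is exact. Let $\mathcal C^\natural$ be the idempotent completion of $\mathcal C$ and $M^\natural$ the monad on $\mathcal C^\natural$ extending $M$, that is, $M^\natural(x,\pi)=(Mx,M\pi)$. Suppose given: 1. an enhancement $(\mathcal A,\epsilon)$ of $\mathcal C$ and a DG monad $\mathbf M$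 on $\mathcal A$ that lifts $M$, in the sense that $\epsilon\circ H^0(\mathbf M)\cong M\circ\epsilon$ (naturally isomorphic functors); 2. a DG monad $\mathrm{Perf}(\mathbf M)$ on $\mathrm{Perf}(\mathcal A)$ that lifts $\mathbf M$, in the sense that $\mathrm{Perf}(\mathbf M)\circ h\cong h\circ\mathbf M$ (isomorphic DG functors); 3. a structure of triangulated category on $M^\natural\text{-}\mathrm{Mod}$ and an enhancement $(\mathcal E,\Phi)$ of it, $\Phi:H^0(\mathcal E)\to M^\natural\text{-}\mathrm{Mod}$; 4. a DG adjunction $\tilde F\dashv\tilde G$, $\tilde F:\mathrm{Perf}(\mathcal A)\to\mathcal E$, $\tilde G:\mathcal E\to\mathrm{Perf}(\mathcal A)$, with $\tilde G\tilde F\cong\mathrm{Perf}(\mathbf M)$ (isomorphic DG functors), which corresponds to $F_{M^\natural}\dashv G_{M^\natural}$ under the enhancements, in the sense that $G_{M^\natural}\circ\Phi\cong\epsilon^\natural\circ H^0(\tilde G)$, where $\epsilon^\natural:H^0(\mathrm{Perf}(\mathcal A))\to\mathcal C^\natural$ is the equivalence with $\epsilon^\natural\circ H^0(h)\cong\iota\circ\epsilon$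 for the canonical functor $\iota:\mathcal C\to\mathcal C^\natural$. Then $M\text{-}\mathrm{Mod}$ admits a structure of triangulated category for which $F_M:\mathcal C\to M\text{-}\mathrm{Mod}$ and $G_M:M\text{-}\mathrm{Mod}\to\mathcal C$ are exact. Moreover, with this structure, $M\text{-}\mathrm{Mod}$ is enhanced by the full DG subcategory $\mathcal Q_M\subseteq\mathcal E$ of all objects $e$ such that $\tilde G e$ is homotopy equivalent in $\mathrm{Perf}(\mathcal A)$ to $h(a)$ for some object $a$ of $\mathcal A$; that is, $\mathcal Q_M$ is pretriangulated and there is an equivalence of triangulated categories $H^0(\mathcal Q_M)\to M\text{-}\mathrm{Mod}$. -/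

import Mathlib

open CategoryTheory CategoryTheory.Limits CategoryTheory.Pretriangulated
open CategoryTheory.Idempotents

universe uk uC vC u u' v w w'

set_option linter.checkUnivs false

/-- A differential graded category over a commutative ring `k` (cohomological grading).
Composition is written in diagrammatic order: `comp f g` is `g ∘ f`, and the Leibniz rule is
`d (g ∘ f) = (d g) ∘ f + (-1) ^ |g| • g ∘ (d f)`. -/
structure DGCat (k : Type uk) [CommRing k] where
  /-- the objects -/
  Obj : Type u
  /-- the degree `n` morphisms -/
  Hom : Obj → Obj → ℤ → Type w
  [addCommGroup : ∀ x y n, AddCommGroup (Hom x y n)]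
  [module : ∀ x y n, Module k (Hom x y n)]
  /-- the differential -/
  d : ∀ {x y : Obj} (n m : ℤ), n + 1 = m → (Hom x y n →ₗ[k] Hom x y m)
  /-- the identities -/
  one : ∀ x : Obj, Hom x x 0
  /-- the composition -/
  comp : ∀ {x y z : Obj} {n m p : ℤ}, n + m = p → (Hom x y n →ₗ[k] Hom y z m →ₗ[k] Hom x z p)
  d_d : ∀ {x y : Obj} (n m p : ℤ) (h : n + 1 = m) (h' : m + 1 = p) (f : Hom x y n),
    d m p h' (d n m h f) = 0
  one_comp : ∀ {x y : Obj} {n : ℤ} (f : Hom x y n), comp (zero_add n) (one x) f = f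
  comp_one : ∀ {x y : Obj} {n : ℤ} (f : Hom x y n), comp (add_zero n) f (one y) = f
  assoc : ∀ {x y z t : Obj} {n m p nm mp q : ℤ} (h₁ : n + m = nm) (h₂ : m + p = mp)
    (h₃ : nm + p = q) (h₄ : n + mp = q) (f : Hom x y n) (g : Hom y z m) (e : Hom z t p),
    comp h₃ (comp h₁ f g) e = comp h₄ f (comp h₂ g e)
  d_comp : ∀ {x y z : Obj} {n m p n' m' p' : ℤ} (h : n + m = p) (hn : n + 1 = n')
    (hm : m + 1 = m') (hp : p + 1 = p') (h₁ : n + m' = p') (h₂ : n' + m = p')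
    (f : Hom x y n) (g : Hom y z m),
    d p p' hp (comp h f g) =
      comp h₁ f (d m m' hm g) + m.negOnePow • comp h₂ (d n n' hn f) g

attribute [instance] DGCat.addCommGroup DGCat.module

namespace DGCat

variable {k : Type uk} [CommRing k] (A : DGCat.{uk, u, w} k)

theorem d_one (x : A.Obj) (m : ℤ) (hm : 0 + 1 = m) : A.d 0 m hm (A.one x) = 0 := by
  subst hm
  have h := A.d_comp (zero_add 0) rfl rfl rfl (by simp) (by simp) (A.one x) (A.one x)
  rw [A.one_comp] at h
  have h₁ : A.comp (zero_add (0 + 1)) (A.one x) (A.d 0 (0 + 1) rfl (A.one x)) =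
    A.d 0 (0 + 1) rfl (A.one x) := A.one_comp _
  have h₂ : A.comp (add_zero (0 + 1)) (A.d 0 (0 + 1) rfl (A.one x)) (A.one x) =
    A.d 0 (0 + 1) rfl (A.one x) := A.comp_one _
  rw [h₁, h₂] at h
  simpa using h

/-- The closed morphisms of degree `n`. -/
def Z (x y : A.Obj) (n : ℤ) : Submodule k (A.Hom x y n) :=
  LinearMap.ker (A.d n (n + 1) rfl)

variable {A} in
theorem d_of_Z {x y : A.Obj} {n : ℤ} (f : A.Z x y n) (m : ℤ) (h : n + 1 = m) :
    A.d n m h f.1 = 0 := by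
  subst h
  exact f.2

/-- The boundaries of degree `n`, as a submodule of the closed morphisms. -/
def B (x y : A.Obj) (n : ℤ) : Submodule k (A.Z x y n) :=
  (LinearMap.range (A.d (x := x) (y := y) (n - 1) n (by omega))).comap (A.Z x y n).subtype

variable {A} in
theorem mem_B_iff {x y : A.Obj} {n : ℤ} (f : A.Z x y n) (m : ℤ) (h : m + 1 = n) :
    f ∈ A.B x y n ↔ ∃ g : A.Hom x y m, A.d m n h g = f.1 := by
  obtain rfl : m = n - 1 := by omega
  rfl

/-- The cohomology `H^n (Hom (x, y))`. -/
abbrev H (x y : A.Obj) (n : ℤ) : Type w := A.Z x y n ⧸ A.B x y n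

variable {A}

/-- The cohomology class of a closed morphism. -/
def cls {x y : A.Obj} {n : ℤ} : A.Z x y n →ₗ[k] A.H x y n := (A.B x y n).mkQ

theorem cls_surjective {x y : A.Obj} {n : ℤ} (f : A.H x y n) : ∃ g, cls g = f :=
  Submodule.mkQ_surjective _ f

/-- The identity as a closed morphism. -/
def oneZ (x : A.Obj) : A.Z x x 0 := ⟨A.one x, A.d_one x _ _⟩

/-- Composition of closed morphisms. -/
def compZ {x y z : A.Obj} {n m p : ℤ} (h : n + m = p) :
    A.Z x y n →ₗ[k] A.Z y z m →ₗ[k] A.Z x z p :=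
  LinearMap.mk₂ k
    (fun f g => ⟨A.comp h f.1 g.1, by
      change A.d p (p + 1) rfl _ = 0
      rw [A.d_comp h rfl rfl rfl (by omega) (by omega), d_of_Z f, d_of_Z g]
      simp⟩)
    (fun _ _ _ => Subtype.ext (by simp))
    (fun _ _ _ => Subtype.ext (by simp))
    (fun _ _ _ => Subtype.ext (by simp))
    (fun _ _ _ => Subtype.ext (by simp))

@[simp]
theorem compZ_val {x y z : A.Obj} {n m p : ℤ} (h : n + m = p) (f : A.Z x y n) (g : A.Z y z m) :
    (compZ h f g).1 = A.comp h f.1 g.1 := rfl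

theorem compZ_mem_B_right {x y z : A.Obj} {n m p : ℤ} (h : n + m = p) (f : A.Z x y n)
    (g : A.Z y z m) (hg : g ∈ A.B y z m) : compZ h f g ∈ A.B x z p := by
  obtain ⟨g', hg'⟩ := (mem_B_iff g (m - 1) (by omega)).1 hg
  refine (mem_B_iff _ (p - 1) (by omega)).2 ⟨A.comp (by omega : n + (m - 1) = p - 1) f.1 g', ?_⟩
  rw [A.d_comp _ rfl (by omega : m - 1 + 1 = m) _ h (by omega), d_of_Z f, hg']
  simp

theorem compZ_mem_B_left {x y z : A.Obj} {n m p : ℤ} (h : n + m = p) (f : A.Z x y n)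
    (g : A.Z y z m) (hf : f ∈ A.B x y n) : compZ h f g ∈ A.B x z p := by
  obtain ⟨f', hf'⟩ := (mem_B_iff f (n - 1) (by omega)).1 hf
  refine (mem_B_iff _ (p - 1) (by omega)).2
    ⟨m.negOnePow • A.comp (by omega : (n - 1) + m = p - 1) f' g.1, ?_⟩
  rw [LinearMap.map_smul_of_tower, A.d_comp _ (by omega : n - 1 + 1 = n) rfl _ (by omega) h, d_of_Z g, hf']
  simp [smul_smul]

/-- Composition of cohomology classes. -/
def compH {x y z : A.Obj} {n m p : ℤ} (h : n + m = p) :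
    A.H x y n →ₗ[k] A.H y z m →ₗ[k] A.H x z p :=
  Submodule.liftQ _
    { toFun := fun f => Submodule.mapQ (A.B y z m) (A.B x z p) (compZ h f)
        (fun g hg => compZ_mem_B_right h f g hg)
      map_add' := fun f f' => by
        ext g
        simp
      map_smul' := fun a f => by
        ext g
        simp }
    (fun f hf => by
      ext g
      exact (Submodule.Quotient.mk_eq_zero _).2 (compZ_mem_B_left h f g hf))

@[simp]
theorem compH_cls {x y z : A.Obj} {n m p : ℤ} (h : n + m = p) (f : A.Z x y n) (g : A.Z y z m) :
    compH h (cls f) (cls g) = cls (compZ h f g) := rfl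

/-- The identity as a cohomology class. -/
def oneH (x : A.Obj) : A.H x x 0 := cls (oneZ x)

theorem oneH_compH {x y : A.Obj} {n : ℤ} (f : A.H x y n) :
    compH (zero_add n) (oneH x) f = f := by
  obtain ⟨f, rfl⟩ := cls_surjective f
  exact congrArg cls (Subtype.ext (A.one_comp f.1))

theorem compH_oneH {x y : A.Obj} {n : ℤ} (f : A.H x y n) :
    compH (add_zero n) f (oneH y) = f := by
  obtain ⟨f, rfl⟩ := cls_surjective f
  exact congrArg cls (Subtype.ext (A.comp_one f.1))

theorem compH_assoc {x y z t : A.Obj} {n m p nm mp q : ℤ} (h₁ : n + m = nm) (h₂ : m + p = mp)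
    (h₃ : nm + p = q) (h₄ : n + mp = q) (f : A.H x y n) (g : A.H y z m) (e : A.H z t p) :
    compH h₃ (compH h₁ f g) e = compH h₄ f (compH h₂ g e) := by
  obtain ⟨f, rfl⟩ := cls_surjective f
  obtain ⟨g, rfl⟩ := cls_surjective g
  obtain ⟨e, rfl⟩ := cls_surjective e
  exact congrArg cls (Subtype.ext (A.assoc h₁ h₂ h₃ h₄ f.1 g.1 e.1))

variable (A) in
/-- The objects of the homotopy category `H^0 (A)`: these are the objects of `A`. -/
structure H0 where
  /-- the underlying object of `A` -/
  obj : A.Obj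

/-- The homotopy category `H^0 (A)`, with morphisms `H^0 (Hom (x, y))`. -/
instance : Category.{w} (H0 A) where
  Hom x y := A.H x.obj y.obj 0
  id x := oneH x.obj
  comp f g := compH (zero_add 0) f g
  id_comp f := oneH_compH f
  comp_id f := compH_oneH f
  assoc f g e := compH_assoc _ _ _ _ f g e

instance (x y : H0 A) : AddCommGroup (x ⟶ y) :=
  inferInstanceAs (AddCommGroup (A.H x.obj y.obj 0))

instance : Preadditive (H0 A) where
  add_comp x y z f f' g := by
    change compH (zero_add 0) (f + f') g = compH (zero_add 0) f g + compH (zero_add 0) f' g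
    simp
  comp_add x y z f g g' := by
    change compH (zero_add 0) f (g + g') = compH (zero_add 0) f g + compH (zero_add 0) f g'
    simp

/-- A cohomology class of degree `0` as a morphism of the homotopy category. -/
def homH0 {x y : A.Obj} (f : A.H x y 0) : (⟨x⟩ : H0 A) ⟶ ⟨y⟩ := f

variable (A) in
/-- The full DG subcategory on the objects satisfying `S`. -/
def full (S : A.Obj → Prop) : DGCat.{uk, u, w} k where
  Obj := { x : A.Obj // S x }
  Hom x y n := A.Hom x.1 y.1 n
  d n m h := A.d n m h
  one x := A.one x.1
  comp h := A.comp h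
  d_d := A.d_d
  one_comp := A.one_comp
  comp_one := A.comp_one
  assoc := A.assoc
  d_comp := A.d_comp

end DGCat

/-- A DG functor. -/
structure DGFunctor {k : Type uk} [CommRing k] (A : DGCat.{uk, u, w} k)
    (B : DGCat.{uk, u', w'} k) where
  /-- the action on objects -/
  obj : A.Obj → B.Obj
  /-- the action on morphisms of degree `n` -/
  map : ∀ {x y : A.Obj} {n : ℤ}, A.Hom x y n →ₗ[k] B.Hom (obj x) (obj y) n
  map_d : ∀ {x y : A.Obj} (n m : ℤ) (h : n + 1 = m) (f : A.Hom x y n),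
    map (A.d n m h f) = B.d n m h (map f)
  map_one : ∀ x : A.Obj, map (A.one x) = B.one (obj x)
  map_comp : ∀ {x y z : A.Obj} {n m p : ℤ} (h : n + m = p) (f : A.Hom x y n) (g : A.Hom y z m),
    map (A.comp h f g) = B.comp h (map f) (map g)

namespace DGFunctor

open DGCat

universe u'' w''

variable {k : Type uk} [CommRing k] {A : DGCat.{uk, u, w} k} {B : DGCat.{uk, u', w'} k}
  {D : DGCat.{uk, u'', w''} k}

/-- The identity DG functor. -/
def id (A : DGCat.{uk, u, w} k) : DGFunctor A A where
  obj x := x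
  map := LinearMap.id
  map_d _ _ _ _ := rfl
  map_one _ := rfl
  map_comp _ _ _ := rfl

/-- The composition `G ∘ F` of DG functors. -/
def comp (F : DGFunctor A B) (G : DGFunctor B D) : DGFunctor A D where
  obj x := G.obj (F.obj x)
  map := G.map ∘ₗ F.map
  map_d n m h f := by simp [F.map_d, G.map_d]
  map_one x := by simp [F.map_one, G.map_one]
  map_comp h f g := by simp [F.map_comp, G.map_comp]

/-- A DG functor that takes values in a full DG subcategory, with restricted codomain. -/
def lift (F : DGFunctor A B) (S : B.Obj → Prop) (hS : ∀ x, S (F.obj x)) :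
    DGFunctor A (B.full S) where
  obj x := ⟨F.obj x, hS x⟩
  map := F.map
  map_d := F.map_d
  map_one := F.map_one
  map_comp := F.map_comp

/-- The action of a DG functor on closed morphisms. -/
def mapZ (F : DGFunctor A B) {x y : A.Obj} {n : ℤ} :
    A.Z x y n →ₗ[k] B.Z (F.obj x) (F.obj y) n :=
  F.map.restrict (fun f hf => by
    change B.d n (n + 1) rfl (F.map f) = 0
    rw [← F.map_d, show A.d n (n + 1) rfl f = 0 from hf, map_zero])

/-- The action of a DG functor on cohomology. -/
def mapH (F : DGFunctor A B) {x y : A.Obj} {n : ℤ} :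
    A.H x y n →ₗ[k] B.H (F.obj x) (F.obj y) n :=
  Submodule.mapQ _ _ F.mapZ (fun f hf => by
    obtain ⟨g, hg⟩ := (mem_B_iff f (n - 1) (by omega)).1 hf
    refine (mem_B_iff _ (n - 1) (by omega)).2 ⟨F.map g, ?_⟩
    rw [← F.map_d, hg]
    rfl)

@[simp]
theorem mapH_cls (F : DGFunctor A B) {x y : A.Obj} {n : ℤ} (f : A.Z x y n) :
    F.mapH (cls f) = cls (F.mapZ f) := rfl

theorem mapH_oneH (F : DGFunctor A B) (x : A.Obj) : F.mapH (oneH x) = oneH (F.obj x) :=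
  congrArg cls (Subtype.ext (F.map_one x))

theorem mapH_compH (F : DGFunctor A B) {x y z : A.Obj} {n m p : ℤ} (h : n + m = p)
    (f : A.H x y n) (g : A.H y z m) :
    F.mapH (compH h f g) = compH h (F.mapH f) (F.mapH g) := by
  obtain ⟨f, rfl⟩ := cls_surjective f
  obtain ⟨g, rfl⟩ := cls_surjective g
  exact congrArg cls (Subtype.ext (F.map_comp h f.1 g.1))

/-- The functor `H^0 (F)` between homotopy categories. -/
def mapH0 (F : DGFunctor A B) : H0 A ⥤ H0 B where
  obj x := ⟨F.obj x.obj⟩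
  map f := F.mapH f
  map_id x := F.mapH_oneH x.obj
  map_comp f g := F.mapH_compH (zero_add 0) f g

end DGFunctor

section

universe u'' w''

variable {k : Type uk} [CommRing k] {A : DGCat.{uk, u, w} k} {B : DGCat.{uk, u', w'} k}

/-- A DG natural transformation: closed morphisms of degree `0`, natural with respect to the
morphisms of all degrees. -/
structure DGNatTrans (F G : DGFunctor A B) where
  /-- the components -/
  app : ∀ x : A.Obj, B.Hom (F.obj x) (G.obj x) 0
  d_app : ∀ x : A.Obj, B.d 0 1 (zero_add 1) (app x) = 0
  naturality : ∀ {x y : A.Obj} {n : ℤ} (f : A.Hom x y n),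
    B.comp (add_zero n) (F.map f) (app y) = B.comp (zero_add n) (app x) (G.map f)

/-- A DG natural isomorphism. -/
structure DGNatIso (F G : DGFunctor A B) where
  /-- the isomorphism -/
  hom : DGNatTrans F G
  /-- its inverse -/
  inv : DGNatTrans G F
  hom_inv : ∀ x : A.Obj, B.comp (zero_add 0) (hom.app x) (inv.app x) = B.one (F.obj x)
  inv_hom : ∀ x : A.Obj, B.comp (zero_add 0) (inv.app x) (hom.app x) = B.one (G.obj x)

/-- A DG monad on `A`. -/
structure DGMonad (A : DGCat.{uk, u, w} k) where
  /-- the underlying DG functor -/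
  functor : DGFunctor A A
  /-- the multiplication -/
  mul : DGNatTrans (functor.comp functor) functor
  /-- the unit -/
  unit : DGNatTrans (DGFunctor.id A) functor
  mul_assoc : ∀ x : A.Obj,
    A.comp (zero_add 0) (functor.map (mul.app x)) (mul.app x) =
      A.comp (zero_add 0) (mul.app (functor.obj x)) (mul.app x)
  unit_mul : ∀ x : A.Obj,
    A.comp (zero_add 0) (unit.app (functor.obj x)) (mul.app x) = A.one (functor.obj x)
  map_unit_mul : ∀ x : A.Obj,
    A.comp (zero_add 0) (functor.map (unit.app x)) (mul.app x) = A.one (functor.obj x)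

/-- A DG adjunction `F ⊣ G`: isomorphisms of complexes `Hom (F a, b) ≅ Hom (a, G b)` that are
natural in both variables. -/
structure DGAdjunction (F : DGFunctor A B) (G : DGFunctor B A) where
  /-- the isomorphism in degree `n` -/
  equiv : ∀ (a : A.Obj) (b : B.Obj) (n : ℤ), B.Hom (F.obj a) b n ≃ₗ[k] A.Hom a (G.obj b) n
  equiv_d : ∀ (a : A.Obj) (b : B.Obj) (n m : ℤ) (h : n + 1 = m) (f : B.Hom (F.obj a) b n),
    equiv a b m (B.d n m h f) = A.d n m h (equiv a b n f)
  naturality_left : ∀ {a a' : A.Obj} {b : B.Obj} {n m p : ℤ} (h : n + m = p)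
    (f : A.Hom a a' n) (g : B.Hom (F.obj a') b m),
    equiv a b p (B.comp h (F.map f) g) = A.comp h f (equiv a' b m g)
  naturality_right : ∀ {a : A.Obj} {b b' : B.Obj} {n m p : ℤ} (h : n + m = p)
    (f : B.Hom (F.obj a) b n) (g : B.Hom b b' m),
    equiv a b' p (B.comp h f g) = A.comp h (equiv a b n f) (G.map g)

end

/-- A right DG module over `A`, that is, a DG functor from the opposite of `A` to complexes of
`k`-modules: `act h f u` is `u · f`. -/
structure DGModule {k : Type uk} [CommRing k] (A : DGCat.{uk, u, w} k) where
  /-- the degree `n` component at `x` -/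
  X : A.Obj → ℤ → Type w
  [addCommGroup : ∀ x n, AddCommGroup (X x n)]
  [module : ∀ x n, Module k (X x n)]
  /-- the differential -/
  d : ∀ {x : A.Obj} (n m : ℤ), n + 1 = m → (X x n →ₗ[k] X x m)
  /-- the action of `A` -/
  act : ∀ {x y : A.Obj} {n m p : ℤ}, n + m = p → (A.Hom x y n →ₗ[k] X y m →ₗ[k] X x p)
  d_d : ∀ {x : A.Obj} (n m p : ℤ) (h : n + 1 = m) (h' : m + 1 = p) (u : X x n),
    d m p h' (d n m h u) = 0
  one_act : ∀ {x : A.Obj} {n : ℤ} (u : X x n), act (zero_add n) (A.one x) u = u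
  act_act : ∀ {x y z : A.Obj} {n m p nm mp q : ℤ} (h₁ : n + m = nm) (h₂ : m + p = mp)
    (h₃ : nm + p = q) (h₄ : n + mp = q) (f : A.Hom x y n) (g : A.Hom y z m) (u : X z p),
    act h₃ (A.comp h₁ f g) u = act h₄ f (act h₂ g u)
  d_act : ∀ {x y : A.Obj} {n m p n' m' p' : ℤ} (h : n + m = p) (hn : n + 1 = n')
    (hm : m + 1 = m') (hp : p + 1 = p') (h₁ : n + m' = p') (h₂ : n' + m = p')
    (f : A.Hom x y n) (u : X y m),
    d p p' hp (act h f u) =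
      act h₁ f (d m m' hm u) + m.negOnePow • act h₂ (A.d n n' hn f) u

attribute [instance] DGModule.addCommGroup DGModule.module

namespace DGModule

open DGCat

variable {k : Type uk} [CommRing k] {A : DGCat.{uk, u, w} k}

/-- The morphisms of degree `n` between right DG modules: homogeneous maps of degree `n` that
commute with the action. -/
def Hom (M N : DGModule A) (n : ℤ) :
    Submodule k (∀ (x : A.Obj) (t : CochainComplex.HomComplex.Triplet n), M.X x t.p →ₗ[k] N.X x t.q) where
  carrier := { φ | ∀ (x y : A.Obj) (a p q p' q' : ℤ) (h : p + n = q) (h' : p' + n = q')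
    (h₁ : a + p = p') (h₂ : a + q = q') (f : A.Hom x y a) (u : M.X y p),
    φ x ⟨p', q', h'⟩ (M.act h₁ f u) = N.act h₂ f (φ y ⟨p, q, h⟩ u) }
  add_mem' := fun {φ ψ} hφ hψ x y a p q p' q' h h' h₁ h₂ f u => by
    simp [hφ x y a p q p' q' h h' h₁ h₂ f u, hψ x y a p q p' q' h h' h₁ h₂ f u]
  zero_mem' := fun x y a p q p' q' h h' h₁ h₂ f u => by simp
  smul_mem' := fun c φ hφ x y a p q p' q' h h' h₁ h₂ f u => by
    simp [hφ x y a p q p' q' h h' h₁ h₂ f u]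

variable {M N L : DGModule A}

theorem Hom.ext' {n : ℤ} {φ ψ : Hom M N n}
    (h : ∀ x p q (h : p + n = q) (u : M.X x p), φ.1 x ⟨p, q, h⟩ u = ψ.1 x ⟨p, q, h⟩ u) : φ = ψ :=
  Subtype.ext (by
    funext x t
    exact LinearMap.ext (h x t.p t.q t.hpq))

/-- The differential `d φ = d ∘ φ - (-1) ^ |φ| • φ ∘ d` of a morphism of DG modules. -/
def homD (n m : ℤ) (hnm : n + 1 = m) : Hom M N n →ₗ[k] Hom M N m where
  toFun φ := ⟨fun x t =>
      N.d (t.p + n) t.q (by have := t.hpq; omega) ∘ₗ φ.1 x ⟨t.p, t.p + n, rfl⟩ -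
        n.negOnePow • (φ.1 x ⟨t.p + 1, t.q, by have := t.hpq; omega⟩ ∘ₗ
          M.d t.p (t.p + 1) rfl), by
    intro x y a p q p' q' h h' h₁ h₂ f u
    have e₁ := φ.2 x y a p (p + n) p' (p' + n) rfl rfl h₁ (by omega) f u
    have e₂ := φ.2 x y a (p + 1) q (p' + 1) q' (by omega) (by omega) (by omega) h₂ f
      (M.d p (p + 1) rfl u)
    have e₃ := φ.2 x y (a + 1) p (p + n) (p' + 1) q' rfl (by omega) (by omega) (by omega)
      (A.d a (a + 1) rfl f) u
    simp only [LinearMap.sub_apply, LinearMap.comp_apply, LinearMap.smul_apply, e₁]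
    rw [M.d_act h₁ rfl rfl rfl (by omega) (by omega),
      N.d_act (by omega : a + (p + n) = p' + n) rfl (by omega : p + n + 1 = q) (by omega) h₂
        (by omega)]
    simp only [map_add, map_sub, LinearMap.map_smul_of_tower, e₂, e₃, smul_add, smul_smul]
    rw [Int.negOnePow_add, mul_comm p.negOnePow n.negOnePow]
    abel⟩
  map_add' φ ψ := Hom.ext' (fun x p q h u => by simp; abel)
  map_smul' c φ := Hom.ext' (fun x p q h u => by
    simp [smul_sub, smul_comm c])

theorem homD_apply {n m : ℤ} (hnm : n + 1 = m) (φ : Hom M N n) {x : A.Obj} {p q r s : ℤ}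
    (h : p + m = q) (hr : p + n = r) (hs : p + 1 = s) (u : M.X x p) :
    (homD n m hnm φ).1 x ⟨p, q, h⟩ u =
      N.d r q (by omega) (φ.1 x ⟨p, r, hr⟩ u) -
        n.negOnePow • φ.1 x ⟨s, q, (by omega)⟩ (M.d p s hs u) := by
  subst hr hs
  rfl

/-- The composition `ψ ∘ φ` of morphisms of DG modules. -/
def homComp {n m p : ℤ} (h : n + m = p) : Hom M N n →ₗ[k] Hom N L m →ₗ[k] Hom M L p :=
  LinearMap.mk₂ k
    (fun φ ψ => ⟨fun x t =>
        ψ.1 x ⟨t.p + n, t.q, by have := t.hpq; omega⟩ ∘ₗ φ.1 x ⟨t.p, t.p + n, rfl⟩, by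
      intro x y a p q p' q' h h' h₁ h₂ f u
      have e₁ := φ.2 x y a p (p + n) p' (p' + n) rfl rfl h₁ (by omega) f u
      have e₂ := ψ.2 x y a (p + n) q (p' + n) q' (by omega) (by omega) (by omega) h₂ f
        (φ.1 y ⟨p, (p + n), rfl⟩ u)
      simp only [LinearMap.comp_apply, e₁, e₂]⟩)
    (fun _ _ _ => Hom.ext' (fun _ _ _ _ _ => by simp))
    (fun _ _ _ => Hom.ext' (fun _ _ _ _ _ => by simp))
    (fun _ _ _ => Hom.ext' (fun _ _ _ _ _ => by simp))
    (fun _ _ _ => Hom.ext' (fun _ _ _ _ _ => by simp))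

theorem homComp_apply {n m p : ℤ} (h : n + m = p) (φ : Hom M N n) (ψ : Hom N L m) {x : A.Obj}
    {a b c : ℤ} (hc : a + p = c) (hb : a + n = b) (u : M.X x a) :
    (homComp h φ ψ).1 x ⟨a, c, hc⟩ u = ψ.1 x ⟨b, c, (by omega)⟩ (φ.1 x ⟨a, b, hb⟩ u) := by
  subst hb
  rfl

/-- The identity of a DG module. -/
def homOne (M : DGModule A) : Hom M M 0 :=
  ⟨fun x t => (by have := t.hpq; omega : t.p = t.q) ▸ LinearMap.id, by
    intro x y a p q p' q' h h' h₁ h₂ f u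
    obtain rfl : p = q := by omega
    obtain rfl : p' = q' := by omega
    rfl⟩

theorem homOne_apply (M : DGModule A) {x : A.Obj} {p : ℤ} (h : p + 0 = p) (u : M.X x p) :
    (homOne M).1 x ⟨p, p, h⟩ u = u := rfl

end DGModule

open DGModule in
/-- The DG category of right DG modules over `A`. -/
def DGCat.Mod {k : Type uk} [CommRing k] (A : DGCat.{uk, u, w} k) :
    DGCat.{uk, max uk u (w + 1), max u w} k where
  Obj := DGModule A
  Hom M N n := DGModule.Hom M N n
  d n m h := homD n m h
  one M := homOne M
  comp h := homComp h
  d_d {M N} n m p h h' φ := Hom.ext' (fun x a b hb u => by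
    rw [homD_apply h' _ hb rfl rfl, homD_apply h φ _ (by omega : a + n = a + n) rfl,
      homD_apply h φ _ (by omega : a + 1 + n = a + m) rfl]
    simp only [map_sub, LinearMap.map_smul_of_tower, N.d_d, M.d_d]
    subst h
    simp [Int.negOnePow_succ])
  one_comp {M N} n φ := Hom.ext' (fun x a b hb u => by
    rw [homComp_apply _ _ _ hb (add_zero a), homOne_apply])
  comp_one {M N} n φ := Hom.ext' (fun x a b hb u => by
    rw [homComp_apply _ _ _ hb hb, homOne_apply])
  assoc {M N L K} n m p nm mp q h₁ h₂ h₃ h₄ φ ψ χ := Hom.ext' (fun x a b hb u => by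
    rw [homComp_apply h₃ _ _ hb rfl, homComp_apply h₁ _ _ rfl rfl, homComp_apply h₄ _ _ hb rfl,
      homComp_apply h₂ _ _ _ (by omega : a + n + m = a + nm)])
  d_comp {M N L} n m p n' m' p' h hn hm hp h₁ h₂ φ ψ := Hom.ext' (fun x a b hb u => by
    have e : p.negOnePow = n.negOnePow * m.negOnePow := by
      rw [← h, Int.negOnePow_add]
    rw [homD_apply hp _ hb rfl rfl, homComp_apply h φ ψ _ rfl,
      homComp_apply h φ ψ _ (by omega : a + 1 + n = a + n')]
    change _ = (homComp h₁ φ (homD m m' hm ψ)).1 x ⟨a, b, hb⟩ u +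
      m.negOnePow • (homComp h₂ (homD n n' hn φ) ψ).1 x ⟨a, b, hb⟩ u
    rw [homComp_apply h₁ _ _ hb rfl, homComp_apply h₂ _ _ hb rfl,
      homD_apply hm ψ _ (by omega : a + n + m = a + p) (by omega : a + n + 1 = a + n'),
      homD_apply hn φ _ rfl rfl]
    simp only [map_sub, LinearMap.map_smul_of_tower, smul_sub, smul_smul, e]
    rw [mul_comm m.negOnePow n.negOnePow]
    abel)

namespace DGCat

variable {k : Type uk} [CommRing k] (A : DGCat.{uk, u, w} k)

/-- The representable right DG module `Hom (-, a)`. -/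
def representable (a : A.Obj) : DGModule A where
  X x n := A.Hom x a n
  d n m h := A.d n m h
  act h := A.comp h
  d_d := A.d_d
  one_act := A.one_comp
  act_act := A.assoc
  d_act := A.d_comp

/-- The morphism of representable DG modules given by composition with a morphism. -/
def yonedaMap {a b : A.Obj} {n : ℤ} :
    A.Hom a b n →ₗ[k] DGModule.Hom (A.representable a) (A.representable b) n where
  toFun g := ⟨fun _ t => (A.comp t.hpq).flip g, by
    intro x y c p q p' q' h h' h₁ h₂ f u
    exact A.assoc h₁ h h' h₂ f u g⟩
  map_add' g g' := DGModule.Hom.ext' (fun x p q h u => map_add (A.comp h u) g g')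
  map_smul' c g := DGModule.Hom.ext' (fun x p q h u => map_smul (A.comp h u) c g)

/-- The Yoneda embedding of `A` in its DG category of right DG modules. -/
def yoneda : DGFunctor A A.Mod where
  obj a := A.representable a
  map := A.yonedaMap
  map_d {a b} n m h g := DGModule.Hom.ext' (fun x p q hq u => by
    change A.comp hq u (A.d n m h g) =
      (DGModule.homD n m h (A.yonedaMap g)).1
        x ⟨p, q, hq⟩ u
    rw [DGModule.homD_apply h _ hq rfl rfl]
    have e := A.d_comp (rfl : p + n = p + n) rfl h (by omega : p + n + 1 = q) hq (by omega)
      (u : A.Hom x a p) g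
    exact eq_sub_of_add_eq e.symm)
  map_one a := DGModule.Hom.ext' (fun x p q h u => by
    obtain rfl : p = q := by omega
    exact A.comp_one u)
  map_comp {a b c n m p} h f g := DGModule.Hom.ext' (fun x r s hs u => by
    change A.comp hs u (A.comp h f g) =
      (DGModule.homComp h (A.yonedaMap f) (A.yonedaMap g)).1 x ⟨r, s, hs⟩ u
    rw [DGModule.homComp_apply h _ _ hs rfl]
    exact (A.assoc rfl h (by omega) hs u f g).symm)

/-- `K` is a cone of the closed degree `0` morphism `f` in the strict sense: as a graded object
it is `x[1] ⊕ y`, and its differential is the usual one. -/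
structure ConeData {A : DGCat.{uk, u, w} k} {x y : A.Obj} (f : A.Z x y 0) (K : A.Obj) where
  /-- the inclusion of the shift of the source -/
  inl : A.Hom x K (-1)
  /-- the inclusion of the target -/
  inr : A.Z y K 0
  /-- the projection to the shift of the source -/
  fst : A.Z K x 1
  /-- the projection to the target -/
  snd : A.Hom K y 0
  d_inl : A.d (-1) 0 (by omega) inl = A.comp (zero_add 0) f.1 inr.1
  d_snd : A.d 0 1 (zero_add 1) snd = -A.comp (add_zero 1) fst.1 f.1
  inl_fst : A.comp (by omega) inl fst.1 = A.one x
  inl_snd : A.comp (add_zero (-1)) inl snd = 0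
  inr_fst : A.comp (zero_add 1) inr.1 fst.1 = 0
  inr_snd : A.comp (zero_add 0) inr.1 snd = A.one y
  total : A.comp (by omega) fst.1 inl + A.comp (zero_add 0) snd inr.1 = A.one K

variable {A}

/-- A cone triangle `x ⟶ y ⟶ c ⟶ x[1]` of `A`, where the last map is a class of degree `1` from
`c` to `x`: under the Yoneda embedding it becomes homotopy equivalent to the standard triangle
on the cone of `f`. The sign is the one of the usual convention for mapping cones. -/
def IsConeTriangle {x y c : A.Obj} (f : A.Z x y 0) (i : A.H y c 0) (p : A.H c x 1) : Prop :=
  ∃ (K : A.Mod.Obj) (D : ConeData (A.yoneda.mapZ f) K) (e : A.Mod.H K (A.yoneda.obj c) 0),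
    IsIso (homH0 e) ∧
    compH (zero_add 0) (cls D.inr) e = A.yoneda.mapH i ∧
    compH (zero_add 1) e (A.yoneda.mapH p) = -cls D.fst

variable (A) in
/-- A DG category is pretriangulated if, up to homotopy equivalence, it has a zero object, all
shifts, and the cones of all closed morphisms of degree `0`. -/
structure IsPretriangulated : Prop where
  exists_zero : ∃ z : A.Obj, oneH z = 0
  exists_shift : ∀ (x : A.Obj) (n : ℤ), ∃ (y : A.Obj) (s : A.H x y (-n)) (t : A.H y x n),
    compH (by omega) s t = oneH x ∧ compH (by omega) t s = oneH y
  exists_cone : ∀ {x y : A.Obj} (f : A.Z x y 0),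
    ∃ (c : A.Obj) (i : A.H y c 0) (p : A.H c x 1), IsConeTriangle f i p

end DGCat

open DGCat in
/-- An enhancement of the triangulated category `T`: the DG category `A` is pretriangulated and
`functor` is an equivalence of triangulated categories from `H^0 (A)` to `T`.
Since the object `y[n]` is characterized by `H^0 (Hom (-, y[n])) = H^n (Hom (-, y))`, the
compatibility with the shifts is an extension of the functor to classes of all degrees, where a
class of degree `n` from `x` to `y` goes to a morphism from the image of `x` to the `n`-th shift
of the image of `y`. Exactness means that cone triangles go to distinguished triangles. -/
structure Enhancement {k : Type uk} [CommRing k] (A : DGCat.{uk, u, w} k)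
    (T : Type u') [Category.{v} T] [Preadditive T] [HasZeroObject T] [HasShift T ℤ]
    [∀ n : ℤ, (shiftFunctor T n).Additive] [Pretriangulated T] where
  isPretriangulated : A.IsPretriangulated
  /-- the equivalence -/
  functor : H0 A ⥤ T
  isEquivalence : functor.IsEquivalence
  /-- the compatibility of the equivalence with the shifts -/
  mapShifted : ∀ {x y : A.Obj} (n : ℤ),
    A.H x y n →+ ShiftedHom (functor.obj ⟨x⟩) (functor.obj ⟨y⟩) n
  mapShifted_zero : ∀ {x y : A.Obj} (f : A.H x y 0),
    mapShifted 0 f = ShiftedHom.mk₀ 0 rfl (functor.map (homH0 f))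
  mapShifted_comp : ∀ {x y z : A.Obj} {n m p : ℤ} (h : n + m = p) (f : A.H x y n)
    (g : A.H y z m),
    mapShifted p (compH h f g) = (mapShifted n f).comp (mapShifted m g) (by omega)
  map_distinguished : ∀ {x y c : A.Obj} (f : A.Z x y 0) (i : A.H y c 0) (p : A.H c x 1),
    IsConeTriangle f i p →
      Triangle.mk (functor.map (homH0 (cls f))) (functor.map (homH0 i)) (mapShifted 1 p) ∈
        distTriang T

attribute [instance] Enhancement.isEquivalence

namespace DGModule

open DGCat

variable {k : Type uk} [CommRing k] {A : DGCat.{uk, u, w} k}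

/-- A semi-free basis of a right DG module: homogeneous elements that form a basis of the
underlying graded module, with ranks such that the differential of a basis element is a
combination of basis elements of smaller rank. -/
structure SemifreeBasis (M : DGModule A) (ι : Type v) where
  /-- the object at which a basis element lives -/
  pt : ι → A.Obj
  /-- the degree of a basis element -/
  deg : ι → ℤ
  /-- the basis elements -/
  gen : ∀ i, M.X (pt i) (deg i)
  /-- the step of the filtration at which a basis element appears -/
  rank : ι → ℕ
  generates : ∀ (x : A.Obj) (n : ℤ) (u : M.X x n), ∃ (s : Finset ι)
    (f : ∀ i, A.Hom x (pt i) (n - deg i)),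
    u = ∑ i ∈ s, M.act (sub_add_cancel n (deg i)) (f i) (gen i)
  independent : ∀ (x : A.Obj) (n : ℤ) (s : Finset ι) (f : ∀ i, A.Hom x (pt i) (n - deg i)),
    ∑ i ∈ s, M.act (sub_add_cancel n (deg i)) (f i) (gen i) = 0 → ∀ i ∈ s, f i = 0
  d_gen : ∀ i, M.d (deg i) (deg i + 1) rfl (gen i) ∈ Submodule.span k
    { u | ∃ (j : ι) (_ : rank j < rank i) (f : A.Hom (pt i) (pt j) (deg i + 1 - deg j)),
      u = M.act (sub_add_cancel _ (deg j)) f (gen j) }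

/-- Semi-free DG modules. -/
def IsSemifree (M : DGModule A) : Prop :=
  ∃ ι : Type (max u w), Nonempty (M.SemifreeBasis ι)

/-- Finitely generated semi-free DG modules. -/
def IsFinSemifree (M : DGModule A) : Prop :=
  ∃ r : ℕ, Nonempty (M.SemifreeBasis (Fin r))

/-- The objects of `Perf (A)`: the semi-free DG modules that are, in the homotopy category,
direct summands of finitely generated semi-free DG modules. -/
def IsPerf (M : DGModule A) : Prop :=
  M.IsSemifree ∧ ∃ L : DGModule A, L.IsFinSemifree ∧
    Nonempty (Retract (⟨M⟩ : H0 A.Mod) (⟨L⟩ : H0 A.Mod))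

end DGModule

namespace DGCat

variable {k : Type uk} [CommRing k] (A : DGCat.{uk, u, w} k)

theorem comp_one_comp_one {x a : A.Obj} {n m : ℤ} (h : n + 0 = m) (h' : m + 0 = n)
    (u : A.Hom x a n) : A.comp h' (A.comp h u (A.one a)) (A.one a) = u := by
  rw [A.assoc h (zero_add 0) h' (add_zero n), A.comp_one, A.comp_one]

/-- The representable DG module on `a` is semi-free on the identity of `a`. -/
def representableBasis (a : A.Obj) (ι : Type v) [Unique ι] :
    (A.representable a).SemifreeBasis ι where
  pt _ := a
  deg _ := 0
  gen _ := A.one a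
  rank _ := 0
  generates x n u := ⟨{default}, fun _ => A.comp (by omega : n + 0 = n - 0) u (A.one a), by
    rw [Finset.sum_singleton]
    exact (A.comp_one_comp_one _ _ u).symm⟩
  independent x n s f h i hi := by
    obtain rfl : s = {default} := by
      ext j
      simpa [Subsingleton.elim j i, Subsingleton.elim i default] using hi
    rw [Finset.sum_singleton, Subsingleton.elim default i] at h
    have h₁ : A.comp (by omega : n - 0 + 0 = n) (f i) (A.one a) = 0 := h
    have h₂ := A.comp_one_comp_one (by omega) (by omega : n + 0 = n - 0) (f i)
    rw [h₁, map_zero, LinearMap.zero_apply] at h₂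
    exact h₂.symm
  d_gen i := by
    rw [show (A.representable a).d 0 (0 + 1) rfl (A.one a) = 0 from A.d_one a _ _]
    exact Submodule.zero_mem _

theorem isPerf_representable (a : A.Obj) : (A.representable a).IsPerf :=
  ⟨⟨PUnit, ⟨A.representableBasis a PUnit⟩⟩, A.representable a,
    ⟨1, ⟨A.representableBasis a (Fin 1)⟩⟩, ⟨Retract.refl _⟩⟩

/-- The DG category `Perf (A)` of perfect DG modules. -/
abbrev Perf : DGCat.{uk, max uk u (w + 1), max u w} k := A.Mod.full DGModule.IsPerf

/-- The Yoneda embedding `A ⟶ Perf (A)`. -/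
def toPerf : DGFunctor A A.Perf := A.yoneda.lift DGModule.IsPerf A.isPerf_representable

end DGCat

section

variable {C : Type u} [Category.{v} C]

/-- The extension of a monad to the idempotent completion. -/
def karoubiMonad (M : Monad C) : Monad (Karoubi C) where
  toFunctor := (functorExtension₂ C C).obj M.toFunctor
  η :=
    { app := fun X => ⟨X.p ≫ M.η.app X.X, by
        have h : X.p ≫ M.η.app X.X = M.η.app X.X ≫ M.map X.p := M.η.naturality X.p
        change X.p ≫ (X.p ≫ M.η.app X.X) ≫ M.map X.p = _
        rw [Category.assoc, ← h, ← Category.assoc, X.idem, ← Category.assoc, X.idem]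
        rfl⟩
      naturality := fun X Y f => by
        have h : f.f ≫ M.η.app Y.X = M.η.app X.X ≫ M.map f.f := M.η.naturality f.f
        ext
        change f.f ≫ Y.p ≫ M.η.app Y.X = (X.p ≫ M.η.app X.X) ≫ M.map f.f
        rw [Category.assoc, ← h, Karoubi.p_comp_assoc, Karoubi.comp_p_assoc] }
  μ :=
    { app := fun X => ⟨M.map (M.map X.p) ≫ M.μ.app X.X, by
        have h : M.map (M.map X.p) ≫ M.μ.app X.X = M.μ.app X.X ≫ M.map X.p := M.μ.naturality X.p
        change M.map (M.map X.p) ≫ (M.map (M.map X.p) ≫ M.μ.app X.X) ≫ M.map X.p = _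
        rw [Category.assoc, ← h]
        simp only [← Functor.map_comp_assoc, ← Functor.map_comp, X.idem]
        rfl⟩
      naturality := fun X Y f => by
        have h : M.map (M.map f.f) ≫ M.μ.app Y.X = M.μ.app X.X ≫ M.map f.f :=
          M.μ.naturality f.f
        ext
        change M.map (M.map f.f) ≫ M.map (M.map Y.p) ≫ M.μ.app Y.X =
          (M.map (M.map X.p) ≫ M.μ.app X.X) ≫ M.map f.f
        rw [Category.assoc, ← h]
        simp only [← Functor.map_comp_assoc, ← Functor.map_comp, Karoubi.p_comp, Karoubi.comp_p] }
  assoc X := by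
    have h : M.map (M.map X.p) ≫ M.μ.app X.X = M.μ.app X.X ≫ M.map X.p := M.μ.naturality X.p
    have h' : M.map (M.map (M.map X.p)) ≫ M.μ.app (M.obj X.X) =
      M.μ.app (M.obj X.X) ≫ M.map (M.map X.p) := M.μ.naturality (M.map X.p)
    have a : M.map (M.μ.app X.X) ≫ M.μ.app X.X = M.μ.app (M.obj X.X) ≫ M.μ.app X.X :=
      M.assoc X.X
    ext
    change M.map (M.map (M.map X.p) ≫ M.μ.app X.X) ≫ M.map (M.map X.p) ≫ M.μ.app X.X =
      (M.map (M.map (M.map X.p)) ≫ M.μ.app (M.obj X.X)) ≫ M.map (M.map X.p) ≫ M.μ.app X.X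
    have e : M.map (M.map X.p) ≫ M.μ.app X.X ≫ M.map X.p = M.μ.app X.X ≫ M.map X.p := by
      rw [← h, ← Functor.map_comp_assoc, ← Functor.map_comp, X.idem]
    rw [h, h', Functor.map_comp, Category.assoc, Category.assoc]
    exact (congrArg (M.map (M.μ.app X.X) ≫ ·) e).trans
      ((show _ = M.μ.app (M.obj X.X) ≫ M.μ.app X.X ≫ M.map X.p by
        rw [← Category.assoc, a, Category.assoc]).trans (congrArg (M.μ.app (M.obj X.X) ≫ ·) e).symm)
  left_unit X := by
    have h : M.map X.p ≫ M.η.app (M.obj X.X) = M.η.app (M.obj X.X) ≫ M.map (M.map X.p) :=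
      M.η.naturality (M.map X.p)
    have a : M.η.app (M.obj X.X) ≫ M.μ.app X.X = 𝟙 _ := M.left_unit X.X
    have b : M.map (M.map X.p) ≫ M.μ.app X.X = M.μ.app X.X ≫ M.map X.p := M.μ.naturality X.p
    ext
    change (M.map X.p ≫ M.η.app (M.obj X.X)) ≫ M.map (M.map X.p) ≫ M.μ.app X.X = M.map X.p
    rw [b, Category.assoc, reassoc_of% a, ← Functor.map_comp, X.idem]
  right_unit X := by
    have a : M.map (M.η.app X.X) ≫ M.μ.app X.X = 𝟙 _ := M.right_unit X.X
    have b : M.map (M.map X.p) ≫ M.μ.app X.X = M.μ.app X.X ≫ M.map X.p := M.μ.naturality X.p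
    ext
    change M.map (X.p ≫ M.η.app X.X) ≫ M.map (M.map X.p) ≫ M.μ.app X.X = M.map X.p
    rw [b, Functor.map_comp, Category.assoc, reassoc_of% a, ← Functor.map_comp, X.idem]

instance (M : Monad C) [Preadditive C] [M.toFunctor.Additive] :
    (karoubiMonad M).toFunctor.Additive where
  map_add {X Y f g} := by
    ext
    exact M.toFunctor.map_add (f := f.f) (g := g.f)

end

open DGCat in
/-- The equivalence from the idempotent completion of `T` to `H^0 (Perf (A))` that extends
`H^0` of the Yoneda embedding, where `H^0 (Perf (A))` is identified with its own idempotent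
completion. -/
noncomputable def Enhancement.karoubiToPerf {k : Type uk} [CommRing k] {A : DGCat.{uk, u, w} k}
    {T : Type u'} [Category.{v} T] [Preadditive T] [HasZeroObject T] [HasShift T ℤ]
    [∀ n : ℤ, (shiftFunctor T n).Additive] [Pretriangulated T] (ε : Enhancement A T) :
    Karoubi T ⥤ Karoubi (H0 A.Perf) :=
  (functorExtension₂ T (H0 A.Perf)).obj (ε.functor.inv ⋙ A.toPerf.mapH0)

/-- The full DG subcategory of `E` of the objects `e` such that `G e` is homotopy equivalent to
the image of an object of `A`. -/
abbrev DGFunctor.Q {k : Type uk} [CommRing k] {A : DGCat.{uk, u, w} k}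
    {E : DGCat.{uk, u', w'} k} (G : DGFunctor E A.Perf) : DGCat.{uk, u', w'} k :=
  E.full (fun e => ∃ a : A.Obj,
    Nonempty ((⟨G.obj e⟩ : DGCat.H0 A.Perf) ≅ ⟨A.toPerf.obj a⟩))

/-! An `M`-module is the same as a module over `karoubiMonad M` whose underlying object lies in `C`:
`karoubiAlgebra` is fully faithful, and its essential image is detected on underlying objects
(`essImage_karoubiAlgebra_iff`). Read through `Φ` and `karoubiToPerf`, this condition on an object
`e` of `E` says that `G e` is homotopy equivalent to a representable module (`Enhancement.isQ_iff`).
Hence the essential image corresponds to `G.Q`, and the main point is that this class of objects is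
closed under zero objects, shifts and cones.

Cones carry the argument. If `G x` and `G y` come from `a` and `b`, the image of a morphism `x ⟶ y`
comes from some `a ⟶ b`, because the Yoneda embedding is fully faithful. This morphism has a cone
`d` in `A`, and the image of `d` and the image under `G` of the cone of `x ⟶ y` are cones of
isomorphic morphisms, hence isomorphic (`IsHomotopyCone.exists_iso`). Cone triangles are defined
through strict cones of modules over the DG category at hand, which a DG functor out of it does not
visibly transport. `HomotopyCone` therefore records the same data as equations between morphisms of
the category itself; every DG functor preserves them and a fully faithful one reflects them. The
entry from `x` to `y` of the homotopy on the cone is never needed and is not recorded.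

So the essential image is a triangulated subcategory, `M.Algebra` inherits its structure, octahedral
axiom included, and the restriction of `Φ` to `G.Q` is an enhancement (`Enhancement.full`).

Exactness of the forgetful functor is checked on the enhancement: there it is isomorphic to the lift
of `G` to the homotopy category of `A`, followed by `ε`. That composite is compatible with shifts
and sends cone triangles to distinguished ones (`Enhancement.distinguished_compLiftH`), which
suffices by `Enhancement.exists_commShift_isTriangulated`. The free module functor is exact as the
left adjoint of an exact functor. -/

namespace DGCat

variable {k : Type uk} [CommRing k] {A : DGCat.{uk, u, w} k}

/-! ### Cones up to homotopy, in terms of matrix entries. -/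

theorem d_comp_of_Z_left {x y z : A.Obj} {n m p m' p' : ℤ} (h : n + m = p) (hm : m + 1 = m')
    (hp : p + 1 = p') (h₁ : n + m' = p') (f : A.Z x y n) (g : A.Hom y z m) :
    A.d p p' hp (A.comp h f.1 g) = A.comp h₁ f.1 (A.d m m' hm g) := by
  rw [A.d_comp h rfl hm hp h₁ (by omega), d_of_Z f, map_zero, LinearMap.zero_apply, smul_zero,
    add_zero]

theorem d_comp_of_Z_right {x y z : A.Obj} {n m p n' p' : ℤ} (h : n + m = p) (hn : n + 1 = n')
    (hp : p + 1 = p') (h₁ : n' + m = p') (f : A.Hom x y n) (g : A.Z y z m) :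
    A.d p p' hp (A.comp h f g.1) = m.negOnePow • A.comp h₁ (A.d n n' hn f) g.1 := by
  rw [A.d_comp h hn rfl hp (by omega) h₁, d_of_Z g, map_zero, zero_add]

theorem cls_eq_cls_iff {x y : A.Obj} {n : ℤ} (f g : A.Z x y n) (m : ℤ) (h : m + 1 = n) :
    cls f = cls g ↔ ∃ s : A.Hom x y m, f.1 = g.1 + A.d m n h s := by
  rw [cls, Submodule.mkQ_apply, Submodule.mkQ_apply, Submodule.Quotient.eq, mem_B_iff _ m h]
  refine exists_congr (fun s => ?_)
  rw [Submodule.coe_sub, eq_sub_iff_add_eq', eq_comm]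

/-- An explicit homotopy equivalence between `c` and the cone of `f`, given by its matrix entries
and those of the homotopies. -/
structure HomotopyCone {x y c : A.Obj} (f : A.Z x y 0) (i : A.Z y c 0) (p : A.Z c x 1) where
  /-- the component on the shift of the source of the map from the cone to `c` -/
  inl : A.Hom x c (-1)
  /-- the component on the target of the map from `c` to the cone -/
  snd : A.Hom c y 0
  d_inl : A.d (-1) 0 (by omega) inl = A.comp (zero_add 0) f.1 i.1
  d_snd : A.d 0 1 (zero_add 1) snd = -A.comp (add_zero 1) p.1 f.1
  /-- the homotopy on `c` -/
  hc : A.Hom c c (-1)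
  total : A.comp (by omega) p.1 inl + A.comp (zero_add 0) snd i.1 =
    A.one c + A.d (-1) 0 (by omega) hc
  /-- the component from `y` to `x` of the homotopy on the cone -/
  hyx : A.Hom y x 0
  inr_fst : A.comp (zero_add 1) i.1 p.1 = -A.d 0 1 (zero_add 1) hyx
  /-- the component from `y` to `y` of the homotopy on the cone -/
  hyy : A.Hom y y (-1)
  inr_snd : A.comp (zero_add 0) i.1 snd =
    A.one y + A.d (-1) 0 (by omega) hyy + A.comp (zero_add 0) hyx f.1
  /-- the component from `x` to `x` of the homotopy on the cone -/
  hxx : A.Hom x x (-1)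
  inl_fst : A.comp (by omega) inl p.1 =
    A.one x - A.d (-1) 0 (by omega) hxx + A.comp (zero_add 0) f.1 hyx

/-- A triangle that is, up to homotopy equivalence, the triangle on the cone of `f`, with the same
sign convention as in `IsConeTriangle`. -/
def IsHomotopyCone {x y c : A.Obj} (f : A.Z x y 0) (i : A.H y c 0) (p : A.H c x 1) : Prop :=
  ∃ (i' : A.Z y c 0) (p' : A.Z c x 1), cls i' = i ∧ cls p' = -p ∧
    Nonempty (HomotopyCone f i' p')

/-- An object homotopy equivalent to a strict cone is a cone up to homotopy. -/
def ConeData.homotopyCone {x y c K : A.Obj} {f : A.Z x y 0} (D : ConeData f K) (a : A.Z K c 0)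
    (b : A.Z c K 0) (H : A.Hom K K (-1))
    (hH : A.comp (zero_add 0) a.1 b.1 = A.one K + A.d (-1) 0 (by omega) H) (h : A.Hom c c (-1))
    (hh : A.comp (zero_add 0) b.1 a.1 = A.one c + A.d (-1) 0 (by omega) h) :
    HomotopyCone f (compZ (zero_add 0) D.inr a) (compZ (zero_add 1) b D.fst) where
  inl := A.comp (add_zero (-1)) D.inl a.1
  snd := A.comp (zero_add 0) b.1 D.snd
  d_inl := by
    rw [d_comp_of_Z_right _ (by omega : -1 + 1 = (0 : ℤ)) _ (zero_add 0), D.d_inl, compZ_val,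
      A.assoc _ (zero_add 0) _ (zero_add 0)]
    simp
  d_snd := by
    rw [d_comp_of_Z_left _ (zero_add 1) _ (zero_add 1), D.d_snd, compZ_val,
      A.assoc _ (add_zero 1) _ (zero_add 1), map_neg]
  hc := h
  total := by
    -- The decomposition `D.total` of the identity of `K` is inserted between `b` and `a`.
    have e := congrArg (fun g => A.comp (zero_add 0) b.1 (A.comp (zero_add 0) g a.1)) D.total
    simp only [map_add, LinearMap.add_apply, A.one_comp] at e
    rw [← hh, compZ_val, compZ_val, A.assoc _ (by omega : (1 : ℤ) + -1 = 0) _ (zero_add 0),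
      A.assoc _ (zero_add 0) _ (zero_add 0), ← e,
      A.assoc (by omega : (1 : ℤ) + -1 = 0) (add_zero (-1)) (zero_add 0) (by omega),
      A.assoc (zero_add 0) (zero_add 0) (zero_add 0) (zero_add 0) D.snd]
  -- The entries of `H` are read off with the inclusions and projections of the cone. As `fst` has
  -- odd degree, composing with it changes the sign of the differential; hence the minus signs in
  -- `inr_fst` and `inl_fst`.
  hyx := A.comp (by omega : -1 + 1 = (0 : ℤ)) (A.comp (zero_add (-1)) D.inr.1 H) D.fst.1
  inr_fst := by
    have e : A.comp (zero_add 1) a.1 (A.comp (zero_add 1) b.1 D.fst.1) =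
        A.comp (zero_add 1) (A.one K + A.d (-1) 0 (by omega) H) D.fst.1 := by
      rw [← A.assoc (zero_add 0) (zero_add 1) (zero_add 1) _, hH]
    rw [compZ_val, compZ_val, A.assoc _ (zero_add 1) _ (zero_add 1), e,
      d_comp_of_Z_right _ (by omega : -1 + 1 = (0 : ℤ)) _ (zero_add 1),
      d_comp_of_Z_left _ (by omega : -1 + 1 = (0 : ℤ)) _ (zero_add 0), map_add,
      LinearMap.add_apply, map_add, A.one_comp, D.inr_fst, zero_add,
      A.assoc _ (zero_add 1) _ (zero_add 1)]
    simp
  hyy := A.comp (add_zero (-1)) (A.comp (zero_add (-1)) D.inr.1 H) D.snd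
  inr_snd := by
    have e : A.comp (zero_add 0) a.1 (A.comp (zero_add 0) b.1 D.snd) =
        A.comp (zero_add 0) (A.one K + A.d (-1) 0 (by omega) H) D.snd := by
      rw [← A.assoc (zero_add 0) (zero_add 0) (zero_add 0) _, hH]
    rw [compZ_val, A.assoc _ (zero_add 0) _ (zero_add 0), e,
      A.d_comp _ (by omega : -1 + 1 = (0 : ℤ)) (zero_add 1) _ (by omega) (add_zero 0),
      d_comp_of_Z_left _ (by omega : -1 + 1 = (0 : ℤ)) _ (zero_add 0), map_add,
      LinearMap.add_apply, map_add, A.one_comp, D.inr_snd, D.d_snd,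
      A.assoc _ (add_zero 1) _ (by omega : -1 + 1 = (0 : ℤ)),
      A.assoc _ (zero_add 0) _ (zero_add 0)]
    simp
    abel
  hxx := A.comp (by omega : -2 + 1 = (-1 : ℤ)) (A.comp (by omega : -1 + -1 = (-2 : ℤ)) D.inl H)
    D.fst.1
  inl_fst := by
    have e : A.comp (zero_add 1) a.1 (A.comp (zero_add 1) b.1 D.fst.1) =
        A.comp (zero_add 1) (A.one K + A.d (-1) 0 (by omega) H) D.fst.1 := by
      rw [← A.assoc (zero_add 0) (zero_add 1) (zero_add 1) _, hH]
    rw [compZ_val, A.assoc _ (zero_add 1) _ (by omega), e,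
      d_comp_of_Z_right _ (by omega : -2 + 1 = (-1 : ℤ)) _ (by omega),
      A.d_comp _ (by omega : -1 + 1 = (0 : ℤ)) (by omega : -1 + 1 = (0 : ℤ)) _ (by omega)
      (by omega), map_add,
      LinearMap.add_apply, map_add, A.one_comp, D.inl_fst, D.d_inl]
    rw [map_add, LinearMap.add_apply, A.assoc _ (by omega : 0 + 1 = (1 : ℤ)) _ (by omega),
      LinearMap.map_smul_of_tower, LinearMap.smul_apply,
      A.assoc (zero_add 0) (zero_add (-1)) _ (zero_add (-1)),
      A.assoc _ (by omega : -1 + 1 = (0 : ℤ)) _ (zero_add 0)]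
    simp
    abel

/-- The maps out of a cone. -/
theorem HomotopyCone.exists_desc {x y c z : A.Obj} {f : A.Z x y 0} {i : A.Z y c 0} {p : A.Z c x 1}
    (T : HomotopyCone f i p) (n : A.Hom x z (-1)) (m : A.Z y z 0)
    (h : A.d (-1) 0 (by omega) n = A.comp (zero_add 0) f.1 m.1) :
    ∃ (φ : A.Z c z 0) (a : A.Hom y z (-1)),
      φ.1 = A.comp (by omega) p.1 n + A.comp (zero_add 0) T.snd m.1 ∧
      A.comp (zero_add 0) i.1 φ.1 = m.1 + A.d (-1) 0 (by omega) a := by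
  -- The first witness is the map from `c` to the cone followed by the map with components `n` and
  -- `m`. The second is the row starting at `y` of the homotopy on the cone, followed by the same
  -- map.
  refine ⟨⟨A.comp (by omega) p.1 n + A.comp (zero_add 0) T.snd m.1, ?_⟩,
    A.comp (add_zero (-1)) T.hyy m.1 + A.comp (zero_add (-1)) T.hyx n, rfl, ?_⟩
  · change A.d 0 (0 + 1) rfl _ = 0
    rw [map_add, d_comp_of_Z_left _ (by omega : -1 + 1 = (0 : ℤ)) _ (by omega), h,
      d_comp_of_Z_right _ (zero_add 1) _ (by omega), T.d_snd, map_neg, LinearMap.neg_apply,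
      A.assoc (add_zero 1) (zero_add 0) _ (by omega)]
    simp
  · rw [map_add, map_add, ← A.assoc (zero_add 1) (by omega : (1 : ℤ) + -1 = 0) (by omega) _,
      ← A.assoc (zero_add 0) (zero_add 0) (zero_add 0) _, T.inr_fst, T.inr_snd,
      d_comp_of_Z_right _ (by omega : -1 + 1 = (0 : ℤ)) _ (by omega),
      A.d_comp _ (zero_add 1) (by omega : -1 + 1 = (0 : ℤ)) _ (by omega) (by omega), h]
    simp only [map_add, map_neg, LinearMap.add_apply, LinearMap.neg_apply, A.one_comp,
      A.assoc (zero_add 0) (zero_add 0) (zero_add 0) (zero_add 0)]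
    simp
    abel

/-- Cones are functorial up to homotopy. -/
theorem HomotopyCone.exists_map {x y c x' y' c' : A.Obj} {f : A.Z x y 0} {i : A.Z y c 0}
    {p : A.Z c x 1} {f' : A.Z x' y' 0} {i' : A.Z y' c' 0} {p' : A.Z c' x' 1}
    (T : HomotopyCone f i p) (T' : HomotopyCone f' i' p') (u : A.Z x x' 0) (v : A.Z y y' 0)
    (s : A.Hom x y' (-1))
    (hs : A.comp (zero_add 0) u.1 f'.1 = A.comp (zero_add 0) f.1 v.1 + A.d (-1) 0 (by omega) s) :
    ∃ (φ : A.Z c c' 0) (a : A.Hom y c' (-1)) (b : A.Hom c x' 0),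
      A.comp (zero_add 0) i.1 φ.1 = A.comp (zero_add 0) v.1 i'.1 + A.d (-1) 0 (by omega) a ∧
      A.comp (zero_add 1) φ.1 p'.1 = A.comp (add_zero 1) p.1 u.1 + A.d 0 1 (zero_add 1) b := by
  -- The component on the shifted source: the square commutes only up to `s`, and `s` followed by
  -- `i'` is the correction that makes `n` a null homotopy of `f` followed by `v` and `i'`.
  let n : A.Hom x c' (-1) :=
    A.comp (zero_add (-1)) u.1 T'.inl - A.comp (add_zero (-1)) s i'.1
  have dn : A.d (-1) 0 (by omega) n =
      A.comp (zero_add 0) f.1 (compZ (zero_add 0) v i').1 := by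
    rw [map_sub, d_comp_of_Z_left _ (by omega : -1 + 1 = (0 : ℤ)) _ (zero_add 0), T'.d_inl,
      d_comp_of_Z_right _ (by omega : -1 + 1 = (0 : ℤ)) _ (zero_add 0),
      ← A.assoc (zero_add 0) _ (zero_add 0), hs]
    simp [A.assoc (zero_add 0) (zero_add 0) (zero_add 0) (zero_add 0)]
  obtain ⟨φ, a, hφ, ha⟩ := T.exists_desc n _ dn
  -- The last term is not a boundary. After composition with `p` it cancels against `T.d_snd` in the
  -- differential of the second term of the homotopy chosen below.
  obtain ⟨r, hn⟩ : ∃ r : A.Hom x x' (-1), A.comp (by omega) n p'.1 =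
      u.1 + A.d (-1) 0 (by omega) r +
        A.comp (zero_add 0) f.1 (A.comp (zero_add 0) v.1 T'.hyx) := by
    refine ⟨A.comp (add_zero (-1)) s T'.hyx - A.comp (zero_add (-1)) u.1 T'.hxx, ?_⟩
    rw [map_sub, LinearMap.sub_apply, A.assoc _ (by omega : -1 + 1 = (0 : ℤ)) _ (zero_add 0),
      T'.inl_fst, A.assoc _ (zero_add 1) _ (by omega : -1 + 1 = (0 : ℤ)), T'.inr_fst, map_sub,
      A.d_comp _ (by omega : -1 + 1 = (0 : ℤ)) (zero_add 1) _ (by omega) (zero_add 0),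
      d_comp_of_Z_left _ (by omega : -1 + 1 = (0 : ℤ)) _ (zero_add 0)]
    have e := congrArg (fun g => A.comp (zero_add 0) g T'.hyx) hs
    simp only [map_add, LinearMap.add_apply,
      A.assoc (zero_add 0) (zero_add 0) (zero_add 0) (zero_add 0)] at e
    simp only [map_add, map_sub, map_neg, e, A.comp_one, Int.negOnePow_zero, one_smul]
    abel
  refine ⟨φ, a, A.comp (by omega) p.1 r -
    A.comp (zero_add 0) T.snd (A.comp (zero_add 0) v.1 T'.hyx), ha, ?_⟩
  rw [hφ, map_add, LinearMap.add_apply, A.assoc _ (by omega : -1 + 1 = (0 : ℤ)) _ (by omega), hn,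
    A.assoc _ (zero_add 1) _ (by omega), compZ_val, A.assoc _ (zero_add 1) _ (by omega),
    T'.inr_fst, map_sub, d_comp_of_Z_left _ (by omega : -1 + 1 = (0 : ℤ)) _ (add_zero 1),
    A.d_comp _ (zero_add 1) (zero_add 1) _ (zero_add 1) (add_zero 1), T.d_snd,
    d_comp_of_Z_left _ (zero_add 1) _ (zero_add 1)]
  simp only [map_add, map_neg, LinearMap.neg_apply, Int.negOnePow_zero, one_smul,
    A.assoc (add_zero 1) (zero_add 0) (add_zero 1) (add_zero 1)]
  abel

/-- By `total`, `n` is homotopic to the sum of its composites through `x` and through `y`. The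
second is `T.snd` followed by the boundary of `t`, which the Leibniz rule turns into a boundary and
a further term through `p`, so everything factors through `p`. -/
theorem HomotopyCone.exists_factor_left {x y c z : A.Obj} {f : A.Z x y 0} {i : A.Z y c 0}
    {p : A.Z c x 1} (T : HomotopyCone f i p) (n : A.Z c z 0) (t : A.Hom y z (-1))
    (ht : A.comp (zero_add 0) i.1 n.1 = A.d (-1) 0 (by omega) t) :
    ∃ (g : A.Z x z (-1)) (s : A.Hom c z (-1)),
      n.1 = A.comp (by omega) p.1 g.1 + A.d (-1) 0 (by omega) s := by
  refine ⟨⟨A.comp (add_zero (-1)) T.inl n.1 - A.comp (zero_add (-1)) f.1 t, ?_⟩,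
    A.comp (zero_add (-1)) T.snd t - A.comp (add_zero (-1)) T.hc n.1, ?_⟩
  · change A.d (-1) (-1 + 1) rfl _ = 0
    rw [map_sub, d_comp_of_Z_right _ (by omega : -1 + 1 = (0 : ℤ)) _ (by omega), T.d_inl,
      d_comp_of_Z_left _ (by omega : -1 + 1 = (0 : ℤ)) _ (by omega), ← ht,
      A.assoc _ (zero_add 0) _ (by omega)]
    simp
  · have e := congrArg (fun g => A.comp (zero_add 0) g n.1) T.total
    simp only [map_add, LinearMap.add_apply, A.one_comp] at e
    rw [A.assoc (by omega) (add_zero (-1)) (zero_add 0) (by omega),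
      A.assoc (zero_add 0) (zero_add 0) (zero_add 0) (zero_add 0), ht] at e
    refine (eq_sub_of_add_eq e.symm).trans ?_
    rw [map_sub, map_sub, d_comp_of_Z_right _ (by omega : -1 + 1 = (0 : ℤ)) _ (zero_add 0),
      A.d_comp _ (zero_add 1) (by omega : -1 + 1 = (0 : ℤ)) _ (zero_add 0) (by omega), T.d_snd,
      map_neg, LinearMap.neg_apply,
      A.assoc (add_zero 1) (zero_add (-1)) _ (by omega)]
    simp
    abel

/-- Dual to `exists_factor_left`: in the expansion of `n` by `total`, the part through `x` is the
boundary of `t` followed by `T.inl`, and the Leibniz rule with `T.d_inl` moves it to a term through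
`i`. -/
theorem HomotopyCone.exists_factor_right {x y c z : A.Obj} {f : A.Z x y 0} {i : A.Z y c 0}
    {p : A.Z c x 1} (T : HomotopyCone f i p) (n : A.Z z c 0) (t : A.Hom z x 0)
    (ht : A.comp (zero_add 1) n.1 p.1 = A.d 0 1 (zero_add 1) t) :
    ∃ (g : A.Z z y 0) (s : A.Hom z c (-1)),
      n.1 = A.comp (zero_add 0) g.1 i.1 + A.d (-1) 0 (by omega) s := by
  have hz : A.d 0 1 (zero_add 1)
      (A.comp (zero_add 0) t f.1 + A.comp (zero_add 0) n.1 T.snd) = 0 := by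
    rw [map_add, d_comp_of_Z_right _ (zero_add 1) _ (add_zero 1),
      d_comp_of_Z_left _ (zero_add 1) _ (zero_add 1), ← ht, T.d_snd, map_neg,
      A.assoc (zero_add 1) (add_zero 1) _ (zero_add 1)]
    simp
  refine ⟨⟨_, hz⟩, -A.comp (zero_add (-1)) t T.inl - A.comp (zero_add (-1)) n.1 T.hc, ?_⟩
  have e := congrArg (fun g => A.comp (zero_add 0) n.1 g) T.total
  simp only [map_add, A.comp_one] at e
  rw [← A.assoc (zero_add 1) (by omega : (1 : ℤ) + -1 = 0) (by omega) (zero_add 0),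
    ht] at e
  refine (eq_sub_of_add_eq e.symm).trans ?_
  rw [map_sub, map_neg, d_comp_of_Z_left _ (by omega : -1 + 1 = (0 : ℤ)) _ (zero_add 0),
    A.d_comp _ (zero_add 1) (by omega : -1 + 1 = (0 : ℤ)) _ (zero_add 0) (by omega), T.d_inl,
    map_add, LinearMap.add_apply,
    A.assoc (zero_add 0) (zero_add 0) _ (zero_add 0),
    A.assoc (zero_add 0) (zero_add 0) _ (zero_add 0)]
  simp
  abel

/-- A DG functor preserves cones up to homotopy. -/
def HomotopyCone.map {B : DGCat.{uk, u', w'} k} (F : DGFunctor A B) {x y c : A.Obj} {f : A.Z x y 0}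
    {i : A.Z y c 0} {p : A.Z c x 1} (T : HomotopyCone f i p) :
    HomotopyCone (F.mapZ f) (F.mapZ i) (F.mapZ p) where
  inl := F.map T.inl
  snd := F.map T.snd
  d_inl := by rw [← F.map_d, T.d_inl, F.map_comp]; rfl
  d_snd := by rw [← F.map_d, T.d_snd, map_neg, F.map_comp]; rfl
  hc := F.map T.hc
  total := by
    rw [← F.map_d, ← F.map_one, ← map_add, ← T.total, map_add, F.map_comp, F.map_comp]; rfl
  hyx := F.map T.hyx
  inr_fst := by rw [← F.map_d, ← map_neg, ← T.inr_fst, F.map_comp]; rfl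
  hyy := F.map T.hyy
  inr_snd := by
    have e := congrArg F.map T.inr_snd
    rwa [map_add, map_add, F.map_one, F.map_d, F.map_comp, F.map_comp] at e
  hxx := F.map T.hxx
  inl_fst := by
    have e := congrArg F.map T.inl_fst
    rwa [map_add, map_sub, F.map_one, F.map_d, F.map_comp, F.map_comp] at e

/-- A fully faithful DG functor reflects cones up to homotopy. -/
theorem HomotopyCone.of_map {B : DGCat.{uk, u', w'} k} (F : DGFunctor A B)
    (hF : ∀ (x y : A.Obj) (n : ℤ),
      Function.Bijective (F.map : A.Hom x y n → B.Hom (F.obj x) (F.obj y) n))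
    {x y c : A.Obj} {f : A.Z x y 0}
    {i : A.Z y c 0} {p : A.Z c x 1} (T : HomotopyCone (F.mapZ f) (F.mapZ i) (F.mapZ p)) :
    Nonempty (HomotopyCone f i p) := by
  obtain ⟨inl, e₁⟩ := (hF _ _ _).2 T.inl
  obtain ⟨snd, e₂⟩ := (hF _ _ _).2 T.snd
  obtain ⟨hc, e₃⟩ := (hF _ _ _).2 T.hc
  obtain ⟨hyx, e₄⟩ := (hF _ _ _).2 T.hyx
  obtain ⟨hyy, e₅⟩ := (hF _ _ _).2 T.hyy
  obtain ⟨hxx, e₆⟩ := (hF _ _ _).2 T.hxx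
  have h₁ := T.d_inl
  have h₂ := T.d_snd
  have h₃ := T.total
  have h₄ := T.inr_fst
  have h₅ := T.inr_snd
  have h₆ := T.inl_fst
  rw [← e₁] at h₁ h₃ h₆
  rw [← e₂] at h₂ h₃ h₅
  rw [← e₃] at h₃
  rw [← e₄] at h₄ h₅ h₆
  rw [← e₅] at h₅
  rw [← e₆] at h₆
  refine ⟨⟨inl, snd, (hF _ _ _).1 ?_, (hF _ _ _).1 ?_, hc, (hF _ _ _).1 ?_, hyx, (hF _ _ _).1 ?_,
    hyy, (hF _ _ _).1 ?_, hxx, (hF _ _ _).1 ?_⟩⟩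
  · rw [F.map_d, F.map_comp]; exact h₁
  · rw [F.map_d, map_neg, F.map_comp]; exact h₂
  · rw [map_add, map_add, F.map_d, F.map_comp, F.map_comp, F.map_one]; exact h₃
  · rw [map_neg, F.map_d, F.map_comp]; exact h₄
  · rw [map_add, map_add, F.map_d, F.map_comp, F.map_comp, F.map_one]; exact h₅
  · rw [map_add, map_sub, F.map_d, F.map_comp, F.map_comp, F.map_one]; exact h₆

theorem IsHomotopyCone.map {B : DGCat.{uk, u', w'} k} (F : DGFunctor A B) {x y c : A.Obj}
    {f : A.Z x y 0} {i : A.H y c 0} {p : A.H c x 1} (T : IsHomotopyCone f i p) :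
    IsHomotopyCone (F.mapZ f) (F.mapH i) (F.mapH p) := by
  obtain ⟨i', p', rfl, hp, ⟨T⟩⟩ := T
  refine ⟨F.mapZ i', F.mapZ p', rfl, ?_, ⟨T.map F⟩⟩
  rw [← map_neg, ← hp, F.mapH_cls]

/-! ### Exactness and uniqueness of cones in the homotopy category. -/

theorem homH0_oneH (x : A.Obj) : homH0 (oneH x) = 𝟙 (⟨x⟩ : H0 A) := rfl

theorem homH0_sub {x y : A.Obj} (f g : A.H x y 0) : homH0 (f - g) = homH0 f - homH0 g := by
  refine eq_sub_of_add_eq ?_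
  change homH0 (f - g + g) = homH0 f
  rw [sub_add_cancel]

theorem isIso_homH0_iff {x y : A.Obj} (f : A.H x y 0) : IsIso (homH0 f) ↔
    ∃ g : A.H y x 0, compH (zero_add 0) f g = oneH x ∧ compH (zero_add 0) g f = oneH y :=
  ⟨fun ⟨g, h⟩ => ⟨g, h⟩, fun ⟨g, h⟩ => ⟨g, h⟩⟩

theorem IsHomotopyCone.exists_factor_left {x y c z : A.Obj} {f : A.Z x y 0} {i : A.H y c 0}
    {p : A.H c x 1} (T : IsHomotopyCone f i p) (n : A.H c z 0)
    (hn : compH (zero_add 0) i n = 0) :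
    ∃ g : A.H x z (-1), n = compH (by omega) p g := by
  obtain ⟨i, p', rfl, hp, ⟨T⟩⟩ := T
  obtain rfl : p = -cls p' := by rw [hp, neg_neg]
  obtain ⟨n, rfl⟩ := cls_surjective n
  rw [compH_cls, ← map_zero cls, cls_eq_cls_iff _ _ (-1) (by omega)] at hn
  obtain ⟨t, ht⟩ := hn
  obtain ⟨g, s, hs⟩ := T.exists_factor_left n t (ht.trans (zero_add _))
  refine ⟨-cls g, ?_⟩
  simp only [map_neg, LinearMap.neg_apply, neg_neg, compH_cls]
  exact (cls_eq_cls_iff _ _ (-1) (by omega)).2 ⟨s, hs⟩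

theorem IsHomotopyCone.exists_factor_right {x y c z : A.Obj} {f : A.Z x y 0} {i : A.H y c 0}
    {p : A.H c x 1} (T : IsHomotopyCone f i p) (n : A.H z c 0)
    (hn : compH (zero_add 1) n p = 0) :
    ∃ g : A.H z y 0, n = compH (zero_add 0) g i := by
  obtain ⟨i, p', rfl, hp, ⟨T⟩⟩ := T
  obtain rfl : p = -cls p' := by rw [hp, neg_neg]
  obtain ⟨n, rfl⟩ := cls_surjective n
  rw [map_neg, neg_eq_zero, compH_cls, ← map_zero cls, cls_eq_cls_iff _ _ 0 (by omega)] at hn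
  obtain ⟨t, ht⟩ := hn
  obtain ⟨g, s, hs⟩ := T.exists_factor_right n t (ht.trans (zero_add _))
  refine ⟨cls g, ?_⟩
  rw [compH_cls]
  exact (cls_eq_cls_iff _ _ (-1) (by omega)).2 ⟨s, hs⟩

theorem IsHomotopyCone.comp_eq_zero {x y c : A.Obj} {f : A.Z x y 0} {i : A.H y c 0}
    {p : A.H c x 1} (T : IsHomotopyCone f i p) : compH (zero_add 1) i p = 0 := by
  obtain ⟨i, p', rfl, hp, ⟨T⟩⟩ := T
  obtain rfl : p = -cls p' := by rw [hp, neg_neg]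
  rw [map_neg, neg_eq_zero, compH_cls, ← map_zero cls, cls_eq_cls_iff _ _ 0 (by omega)]
  refine ⟨-T.hyx, ?_⟩
  rw [compZ_val, T.inr_fst, map_neg]
  exact (zero_add _).symm

/-- The difference `φ - 1` is killed by `i` on one side and by `p` on the other, so it factors both
as something after `p` and as something before `i`. Its square then contains `i` followed by `p`,
hence vanishes, and `1 - (φ - 1)` is an inverse of `φ`. -/
theorem IsHomotopyCone.isIso_of_comp_eq {x y c : A.Obj} {f : A.Z x y 0} {i : A.H y c 0}
    {p : A.H c x 1} (T : IsHomotopyCone f i p) (φ : A.H c c 0)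
    (h₁ : compH (zero_add 0) i φ = i) (h₂ : compH (zero_add 1) φ p = p) : IsIso (homH0 φ) := by
  obtain ⟨g, hg⟩ := T.exists_factor_left (φ - oneH c) (by
    rw [map_sub, h₁, sub_eq_zero]; exact (compH_oneH i).symm)
  obtain ⟨g', hg'⟩ := T.exists_factor_right (φ - oneH c) (by
    rw [map_sub, LinearMap.sub_apply, h₂, sub_eq_zero]; exact (oneH_compH p).symm)
  have h : compH (zero_add 0) (φ - oneH c) (φ - oneH c) = 0 := by
    nth_rw 1 [hg']
    rw [hg, compH_assoc (zero_add 0) (by omega) (zero_add 0) (zero_add 0),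
      ← compH_assoc (zero_add 1) (by omega : (1 : ℤ) + -1 = 0) (by omega) (zero_add 0),
      T.comp_eq_zero]
    simp
  have e : homH0 φ = 𝟙 _ + homH0 (φ - oneH c) := by rw [homH0_sub, homH0_oneH]; abel
  have h' : homH0 (φ - oneH c) ≫ homH0 (φ - oneH c) = 0 := h
  refine ⟨𝟙 _ - homH0 (φ - oneH c), ?_, ?_⟩ <;>
    rw [e] <;> simp only [Preadditive.comp_sub, Preadditive.sub_comp, Preadditive.comp_add,
      Preadditive.add_comp, h', Category.id_comp, Category.comp_id] <;> abel

theorem IsHomotopyCone.exists_map {x y c x' y' c' : A.Obj} {f : A.Z x y 0} {i : A.H y c 0}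
    {p : A.H c x 1} {f' : A.Z x' y' 0} {i' : A.H y' c' 0} {p' : A.H c' x' 1}
    (T : IsHomotopyCone f i p) (T' : IsHomotopyCone f' i' p') (u : A.H x x' 0) (v : A.H y y' 0)
    (h : compH (zero_add 0) u (cls f') = compH (zero_add 0) (cls f) v) :
    ∃ φ : A.H c c' 0, compH (zero_add 0) i φ = compH (zero_add 0) v i' ∧
      compH (zero_add 1) φ p' = compH (add_zero 1) p u := by
  obtain ⟨i, q, rfl, hp, ⟨T⟩⟩ := T
  obtain rfl : p = -cls q := by rw [hp, neg_neg]
  obtain ⟨i', q', rfl, hp', ⟨T'⟩⟩ := T'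
  obtain rfl : p' = -cls q' := by rw [hp', neg_neg]
  obtain ⟨u, rfl⟩ := cls_surjective u
  obtain ⟨v, rfl⟩ := cls_surjective v
  rw [compH_cls, compH_cls, cls_eq_cls_iff _ _ (-1) (by omega)] at h
  obtain ⟨s, hs⟩ := h
  obtain ⟨φ, a, b, ha, hb⟩ := T.exists_map T' u v s hs
  refine ⟨cls φ, (cls_eq_cls_iff _ _ (-1) (by omega)).2 ⟨a, ha⟩, ?_⟩
  exact ((compH (zero_add 1) (cls φ)).map_neg (cls q')).trans
    ((congrArg Neg.neg ((cls_eq_cls_iff _ _ 0 (by omega)).2 ⟨b, hb⟩)).trans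
      ((compH (add_zero 1)).map_neg₂ (cls q) (cls u)).symm)

/-- Cones of isomorphic morphisms of the homotopy category are isomorphic. -/
theorem IsHomotopyCone.exists_iso {x y c x' y' c' : A.Obj} {f : A.Z x y 0} {i : A.H y c 0}
    {p : A.H c x 1} {f' : A.Z x' y' 0} {i' : A.H y' c' 0} {p' : A.H c' x' 1}
    (T : IsHomotopyCone f i p) (T' : IsHomotopyCone f' i' p') (u : A.H x x' 0) (v : A.H y y' 0)
    (hu : IsIso (homH0 u)) (hv : IsIso (homH0 v))
    (h : compH (zero_add 0) u (cls f') = compH (zero_add 0) (cls f) v) :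
    ∃ φ : A.H c c' 0, IsIso (homH0 φ) ∧ compH (zero_add 0) i φ = compH (zero_add 0) v i' ∧
      compH (zero_add 1) φ p' = compH (add_zero 1) p u := by
  obtain ⟨φ, h₁, h₂⟩ := T.exists_map T' u v h
  obtain ⟨u', hu₁, hu₂⟩ := (isIso_homH0_iff u).1 hu
  obtain ⟨v', hv₁, hv₂⟩ := (isIso_homH0_iff v).1 hv
  obtain ⟨ψ, h₃, h₄⟩ := T'.exists_map T u' v' (by
    have e := congrArg (fun g => compH (zero_add 0) u' (compH (zero_add 0) g v')) h
    rw [compH_assoc (zero_add 0) (zero_add 0) (zero_add 0) (zero_add 0) (cls f), hv₁,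
      compH_assoc (zero_add 0) (zero_add 0) (zero_add 0) (zero_add 0) u,
      ← compH_assoc (zero_add 0) (zero_add 0) (zero_add 0) (zero_add 0), hu₂] at e
    exact (congrArg (compH (zero_add 0) u') (compH_oneH (cls f))).symm.trans
      (e.symm.trans (oneH_compH _)))
  -- Maps between cones are not determined by `u` and `v`, so the two composites need not be
  -- identities. They do fix the structure maps, which makes them invertible, and this is enough.
  have e₁ : IsIso (homH0 φ ≫ homH0 ψ) := T.isIso_of_comp_eq (compH (zero_add 0) φ ψ)
    (by
      rw [← compH_assoc (zero_add 0) (zero_add 0) (zero_add 0) (zero_add 0), h₁,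
        compH_assoc (zero_add 0) (zero_add 0) (zero_add 0) (zero_add 0), h₃,
        ← compH_assoc (zero_add 0) (zero_add 0) (zero_add 0) (zero_add 0), hv₁]
      exact oneH_compH i)
    (by
      rw [compH_assoc (zero_add 0) (zero_add 1) (zero_add 1) (zero_add 1), h₄,
        ← compH_assoc (zero_add 1) (add_zero 1) (add_zero 1) (zero_add 1), h₂,
        compH_assoc (add_zero 1) (zero_add 0) (add_zero 1) (add_zero 1), hu₁]
      exact compH_oneH p)
  have e₂ : IsIso (homH0 ψ ≫ homH0 φ) := T'.isIso_of_comp_eq (compH (zero_add 0) ψ φ)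
    (by
      rw [← compH_assoc (zero_add 0) (zero_add 0) (zero_add 0) (zero_add 0), h₃,
        compH_assoc (zero_add 0) (zero_add 0) (zero_add 0) (zero_add 0), h₁,
        ← compH_assoc (zero_add 0) (zero_add 0) (zero_add 0) (zero_add 0), hv₂]
      exact oneH_compH i')
    (by
      rw [compH_assoc (zero_add 0) (zero_add 1) (zero_add 1) (zero_add 1), h₂,
        ← compH_assoc (zero_add 1) (add_zero 1) (add_zero 1) (zero_add 1), h₄,
        compH_assoc (add_zero 1) (zero_add 0) (add_zero 1) (add_zero 1), hu₂]
      exact compH_oneH p')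
  have : Mono (homH0 φ) := mono_of_mono _ (homH0 ψ)
  have : IsSplitEpi (homH0 φ) := ⟨⟨⟨inv (homH0 ψ ≫ homH0 φ) ≫ homH0 ψ, by
    rw [Category.assoc, IsIso.inv_hom_id]⟩⟩⟩
  exact ⟨φ, isIso_of_mono_of_isSplitEpi _, h₁, h₂⟩

end DGCat

/-! ### Fully faithful DG functors and the Yoneda embedding. -/

namespace DGFunctor

open DGCat

variable {k : Type uk} [CommRing k] {A : DGCat.{uk, u, w} k} {B : DGCat.{uk, u', w'} k}

/-- A DG functor that is bijective on morphisms of all degrees. -/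
def IsFullyFaithful (F : DGFunctor A B) : Prop :=
  ∀ (x y : A.Obj) (n : ℤ), Function.Bijective (F.map : A.Hom x y n → B.Hom (F.obj x) (F.obj y) n)

namespace IsFullyFaithful

variable {F : DGFunctor A B} (hF : F.IsFullyFaithful)
include hF

theorem mapZ_bijective (x y : A.Obj) (n : ℤ) :
    Function.Bijective (F.mapZ : A.Z x y n → B.Z (F.obj x) (F.obj y) n) := by
  refine ⟨fun f g h => Subtype.ext ((hF x y n).1 (congrArg Subtype.val h)), fun g => ?_⟩
  obtain ⟨f, hf⟩ := (hF x y n).2 g.1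
  refine ⟨⟨f, (hF _ _ _).1 ?_⟩, Subtype.ext hf⟩
  rw [F.map_d, hf, map_zero]
  exact g.2

theorem mapH_bijective (x y : A.Obj) (n : ℤ) :
    Function.Bijective (F.mapH : A.H x y n → B.H (F.obj x) (F.obj y) n) := by
  constructor
  · refine (injective_iff_map_eq_zero F.mapH).2 (fun f hf => ?_)
    obtain ⟨f, rfl⟩ := cls_surjective f
    rw [mapH_cls, ← map_zero cls, cls_eq_cls_iff _ _ (n - 1) (by omega)] at hf
    obtain ⟨s, hs⟩ := hf
    obtain ⟨s, rfl⟩ := (hF _ _ _).2 s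
    rw [← map_zero cls, cls_eq_cls_iff _ _ (n - 1) (by omega)]
    refine ⟨s, (hF _ _ _).1 ?_⟩
    rw [map_add, F.map_d, Submodule.coe_zero, map_zero]
    exact hs
  · intro g
    obtain ⟨g, rfl⟩ := cls_surjective g
    obtain ⟨f, rfl⟩ := (hF.mapZ_bijective x y n).2 g
    exact ⟨cls f, rfl⟩

theorem isHomotopyCone_of_map {x y c : A.Obj} {f : A.Z x y 0} {i : A.H y c 0} {p : A.H c x 1}
    (T : IsHomotopyCone (F.mapZ f) (F.mapH i) (F.mapH p)) : IsHomotopyCone f i p := by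
  obtain ⟨i', p', hi, hp, ⟨T⟩⟩ := T
  obtain ⟨i', rfl⟩ := (hF.mapZ_bijective _ _ _).2 i'
  obtain ⟨p', rfl⟩ := (hF.mapZ_bijective _ _ _).2 p'
  refine ⟨i', p', (hF.mapH_bijective _ _ _).1 hi, (hF.mapH_bijective _ _ _).1 ?_,
    T.of_map F hF⟩
  rw [map_neg, ← hp, mapH_cls]

theorem full_mapH0 : F.mapH0.Full :=
  ⟨fun f => (hF.mapH_bijective _ _ _).2 f⟩

theorem faithful_mapH0 : F.mapH0.Faithful :=
  ⟨fun h => (hF.mapH_bijective _ _ _).1 h⟩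

end IsFullyFaithful

end DGFunctor

namespace DGCat

variable {k : Type uk} [CommRing k] (A : DGCat.{uk, u, w} k)

theorem yoneda_isFullyFaithful : A.yoneda.IsFullyFaithful := by
  intro a b n
  constructor
  · intro f g h
    have e := congrArg (fun φ : DGModule.Hom (A.representable a) (A.representable b) n =>
      φ.1 a ⟨0, n, zero_add n⟩ (A.one a)) h
    exact (A.one_comp f).symm.trans (e.trans (A.one_comp g))
  · intro φ
    refine ⟨φ.1 a ⟨0, n, zero_add n⟩ (A.one a), DGModule.Hom.ext' (fun x p q h u => ?_)⟩
    have e := φ.2 x a p 0 n p q (zero_add n) h (add_zero p) h u (A.one a)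
    exact e.symm.trans (congrArg (φ.1 x ⟨p, q, h⟩) (A.comp_one u))

theorem toPerf_isFullyFaithful : A.toPerf.IsFullyFaithful := A.yoneda_isFullyFaithful

variable {A}

/-- The module `K` need not be representable, but the matrix entries of a homotopy equivalence
between `K` and a representable module are morphisms between representables. Full faithfulness of
the Yoneda embedding brings them back to `A`. -/
theorem IsConeTriangle.isHomotopyCone {x y c : A.Obj} {f : A.Z x y 0} {i : A.H y c 0}
    {p : A.H c x 1} (h : IsConeTriangle f i p) : IsHomotopyCone f i p := by
  obtain ⟨K, D, e, he, h₁, h₂⟩ := h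
  obtain ⟨e', he₁, he₂⟩ := (isIso_homH0_iff e).1 he
  obtain ⟨a, rfl⟩ := cls_surjective e
  obtain ⟨b, rfl⟩ := cls_surjective e'
  refine A.yoneda_isFullyFaithful.isHomotopyCone_of_map
    ⟨compZ (zero_add 0) D.inr a, compZ (zero_add 1) b D.fst, h₁, ?_, ?_⟩
  · have e := congrArg (compH (zero_add 1) (cls b)) h₂
    rw [← compH_assoc (zero_add 0) (zero_add 1) (zero_add 1) (zero_add 1), he₂, map_neg] at e
    erw [oneH_compH] at e
    rw [e, neg_neg]
    rfl
  · obtain ⟨H, hH⟩ := (cls_eq_cls_iff (compZ (zero_add 0) a b) (oneZ K) (-1) (by omega)).1 he₁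
    obtain ⟨h, hh⟩ := (cls_eq_cls_iff (compZ (zero_add 0) b a) (oneZ (A.yoneda.obj c)) (-1)
      (by omega)).1 he₂
    exact ⟨D.homotopyCone a b H hH h hh⟩

/-! ### Cone triangles in full DG subcategories. -/

/-- The inclusion of a full DG subcategory. -/
def fullInclusion (S : A.Obj → Prop) : DGFunctor (A.full S) A where
  obj x := x.1
  map := LinearMap.id
  map_d _ _ _ _ := rfl
  map_one _ := rfl
  map_comp _ _ _ := rfl

theorem fullInclusion_isFullyFaithful (S : A.Obj → Prop) :
    (fullInclusion S).IsFullyFaithful := fun _ _ _ => Function.bijective_id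

/-- The restriction of a DG module to a full DG subcategory. -/
def restrictModule (S : A.Obj → Prop) (M : DGModule A) : DGModule (A.full S) where
  X x n := M.X x.1 n
  addCommGroup x n := M.addCommGroup x.1 n
  module x n := M.module x.1 n
  d n m h := M.d n m h
  act h := M.act h
  d_d n m p h h' u := M.d_d n m p h h' u
  one_act u := M.one_act u
  act_act h₁ h₂ h₃ h₄ f g u := M.act_act h₁ h₂ h₃ h₄ f g u
  d_act h hn hm hp h₁ h₂ f u := M.d_act h hn hm hp h₁ h₂ f u

/-- The restriction of a morphism of DG modules to a full DG subcategory. -/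
def restrictHom (S : A.Obj → Prop) {M N : DGModule A} {n : ℤ} :
    DGModule.Hom M N n →ₗ[k] DGModule.Hom (restrictModule S M) (restrictModule S N) n where
  toFun φ := ⟨fun x t => φ.1 x.1 t, fun x y => φ.2 x.1 y.1⟩
  map_add' _ _ := rfl
  map_smul' _ _ := rfl

/-- The restriction of DG modules to a full DG subcategory. -/
def restrict (S : A.Obj → Prop) : DGFunctor A.Mod (A.full S).Mod where
  obj := restrictModule S
  map := restrictHom S
  map_d _ _ _ _ := rfl
  map_one _ := rfl
  map_comp _ _ _ := rfl

/-- The image of a strict cone under a DG functor. -/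
def ConeData.map {B : DGCat.{uk, u', w'} k} (F : DGFunctor A B) {x y K : A.Obj} {f : A.Z x y 0}
    (D : ConeData f K) : ConeData (F.mapZ f) (F.obj K) where
  inl := F.map D.inl
  inr := F.mapZ D.inr
  fst := F.mapZ D.fst
  snd := F.map D.snd
  d_inl := by rw [← F.map_d, D.d_inl, F.map_comp]; rfl
  d_snd := by rw [← F.map_d, D.d_snd, map_neg, F.map_comp]; rfl
  inl_fst := by rw [← F.map_one, ← D.inl_fst, F.map_comp]; rfl
  inl_snd := by rw [← F.map_comp, D.inl_snd, map_zero]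
  inr_fst := by
    have e := congrArg F.map D.inr_fst
    rwa [F.map_comp, map_zero] at e
  inr_snd := by rw [← F.map_one, ← D.inr_snd, F.map_comp]; rfl
  total := by rw [← F.map_one, ← D.total, map_add, F.map_comp, F.map_comp]; rfl

theorem isIso_homH0_mapH {B : DGCat.{uk, u', w'} k} (F : DGFunctor A B) {x y : A.Obj}
    (e : A.H x y 0) (he : IsIso (homH0 e)) : IsIso (homH0 (F.mapH e)) :=
  inferInstanceAs (IsIso (F.mapH0.map (homH0 e)))

/-- The cone triangles of a full DG subcategory. -/
theorem IsConeTriangle.full (S : A.Obj → Prop) {x y c : A.Obj} (hx : S x) (hy : S y) (hc : S c)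
    {f : A.Z x y 0} {i : A.H y c 0} {p : A.H c x 1} (h : IsConeTriangle f i p) :
    IsConeTriangle (A := A.full S) (x := ⟨x, hx⟩) (y := ⟨y, hy⟩) (c := ⟨c, hc⟩) f i p := by
  obtain ⟨K, D, e, he, h₁, h₂⟩ := h
  -- Restriction of modules is a DG functor, so it preserves strict cones and homotopy equivalences;
  -- on objects satisfying `S` it sends representables to representables by definition.
  refine ⟨(restrict S).obj K, D.map (restrict S), (restrict S).mapH e,
    isIso_homH0_mapH _ e he, ?_, ?_⟩
  · have e₁ := congrArg (restrict S).mapH h₁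
    rw [DGFunctor.mapH_compH] at e₁
    obtain ⟨i, rfl⟩ := cls_surjective i
    exact e₁
  · have e₁ := congrArg (restrict S).mapH h₂
    rw [DGFunctor.mapH_compH, map_neg] at e₁
    obtain ⟨p, rfl⟩ := cls_surjective p
    exact e₁

end DGCat

/-! ### Shift functors on the homotopy category. -/

namespace DGCat

variable {k : Type uk} [CommRing k]

/-- A choice of shifts of the objects of a DG category, up to homotopy equivalence. -/
structure ShiftData (A : DGCat.{uk, u, w} k) where
  /-- the shifts -/
  obj : ℤ → A.Obj → A.Obj
  /-- the class from an object to its shift -/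
  toShift : ∀ (n : ℤ) (x : A.Obj), A.H x (obj n x) (-n)
  /-- the class from the shift to the object -/
  ofShift : ∀ (n : ℤ) (x : A.Obj), A.H (obj n x) x n
  toShift_ofShift : ∀ (n : ℤ) (x : A.Obj), compH (by omega) (toShift n x) (ofShift n x) = oneH x
  ofShift_toShift : ∀ (n : ℤ) (x : A.Obj),
    compH (by omega) (ofShift n x) (toShift n x) = oneH (obj n x)

/-- The shifts of a pretriangulated DG category. -/
noncomputable def IsPretriangulated.shiftData {A : DGCat.{uk, u, w} k} (h : A.IsPretriangulated) :
    A.ShiftData where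
  obj n x := (h.exists_shift x n).choose
  toShift n x := (h.exists_shift x n).choose_spec.choose
  ofShift n x := (h.exists_shift x n).choose_spec.choose_spec.choose
  toShift_ofShift n x := (h.exists_shift x n).choose_spec.choose_spec.choose_spec.1
  ofShift_toShift n x := (h.exists_shift x n).choose_spec.choose_spec.choose_spec.2

namespace ShiftData

variable {A : DGCat.{uk, u, w} k} (S : A.ShiftData)

/-- The class `ofShift` is invertible in the graded category, so it can be cancelled. All coherence
identities for shifts are checked in this way, after projection to the unshifted object, where no
choices are left to compare. -/
theorem hom_ext {x z : A.Obj} {n a b : ℤ} (h : a + n = b) {f g : A.H z (S.obj n x) a}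
    (e : compH h f (S.ofShift n x) = compH h g (S.ofShift n x)) : f = g := by
  have e' := congrArg (fun t => compH (by omega : b + -n = a) t (S.toShift n x)) e
  rw [compH_assoc h (by omega : n + -n = 0) _ (add_zero a),
    compH_assoc h (by omega : n + -n = 0) _ (add_zero a), S.ofShift_toShift] at e'
  exact (compH_oneH f).symm.trans (e'.trans (compH_oneH g))

/-- The morphism to the shift of an object that corresponds to a class of nonzero degree. -/
def lift {x z : A.Obj} (n : ℤ) {a b : ℤ} (h : a + n = b) (f : A.H z x b) : A.H z (S.obj n x) a :=
  compH (by omega) f (S.toShift n x)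

theorem lift_ofShift {x z : A.Obj} (n : ℤ) {a b : ℤ} (h : a + n = b) (f : A.H z x b) :
    compH h (S.lift n h f) (S.ofShift n x) = f := by
  rw [lift, compH_assoc _ (by omega : -n + n = 0) _ (add_zero b), S.toShift_ofShift]
  exact compH_oneH f

theorem hom_ext₂ {x z : A.Obj} {n m a b c : ℤ} (h : a + m = b) (h' : b + n = c)
    {f g : A.H z (S.obj m (S.obj n x)) a}
    (e : compH h' (compH h f (S.ofShift m (S.obj n x))) (S.ofShift n x) =
      compH h' (compH h g (S.ofShift m (S.obj n x))) (S.ofShift n x)) : f = g :=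
  S.hom_ext h (S.hom_ext h' e)

/-- The shift of a morphism of the homotopy category. -/
def map (n : ℤ) {x y : A.Obj} (f : A.H x y 0) : A.H (S.obj n x) (S.obj n y) 0 :=
  S.lift n (zero_add n) (compH (add_zero n) (S.ofShift n x) f)

theorem map_ofShift (n : ℤ) {x y : A.Obj} (f : A.H x y 0) :
    compH (zero_add n) (S.map n f) (S.ofShift n y) = compH (add_zero n) (S.ofShift n x) f :=
  S.lift_ofShift _ _ _

theorem map_oneH (n : ℤ) (x : A.Obj) : S.map n (oneH x) = oneH (S.obj n x) :=
  S.hom_ext (zero_add n) (by rw [map_ofShift, compH_oneH, oneH_compH])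

theorem map_compH (n : ℤ) {x y z : A.Obj} (f : A.H x y 0) (g : A.H y z 0) :
    S.map n (compH (zero_add 0) f g) = compH (zero_add 0) (S.map n f) (S.map n g) :=
  S.hom_ext (zero_add n) (by
    rw [map_ofShift, compH_assoc (zero_add 0) (zero_add n) (zero_add n) (zero_add n), map_ofShift,
      ← compH_assoc (zero_add n) (add_zero n) (add_zero n) (zero_add n), map_ofShift,
      compH_assoc (add_zero n) (zero_add 0) (add_zero n) (add_zero n)])

/-- The comparison of the shift by a sum with the iterated shift. -/
def addHom (n m : ℤ) (x : A.Obj) : A.H (S.obj (n + m) x) (S.obj m (S.obj n x)) 0 :=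
  S.lift m (zero_add m) (S.lift n (by omega) (S.ofShift (n + m) x))

theorem addHom_ofShift (n m : ℤ) (x : A.Obj) :
    compH (by omega) (compH (zero_add m) (S.addHom n m x) (S.ofShift m (S.obj n x)))
      (S.ofShift n x) = S.ofShift (n + m) x := by
  rw [addHom, lift_ofShift, lift_ofShift]

theorem addHom_comp_ofShift (n m : ℤ) (x : A.Obj) :
    compH (zero_add (n + m)) (S.addHom n m x)
      (compH (by omega) (S.ofShift m (S.obj n x)) (S.ofShift n x)) = S.ofShift (n + m) x := by
  rw [← S.addHom_ofShift n m x, compH_assoc]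

/-- The inverse of `addHom`. -/
def addInv (n m : ℤ) (x : A.Obj) : A.H (S.obj m (S.obj n x)) (S.obj (n + m) x) 0 :=
  S.lift (n + m) (zero_add _) (compH (by omega) (S.ofShift m _) (S.ofShift n x))

theorem addInv_ofShift (n m : ℤ) (x : A.Obj) :
    compH (zero_add (n + m)) (S.addInv n m x) (S.ofShift (n + m) x) =
      compH (by omega) (S.ofShift m _) (S.ofShift n x) := S.lift_ofShift _ _ _

theorem addHom_addInv (n m : ℤ) (x : A.Obj) :
    compH (zero_add 0) (S.addHom n m x) (S.addInv n m x) = oneH _ :=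
  S.hom_ext (zero_add (n + m)) (by
    rw [compH_assoc (zero_add 0) (zero_add _) (zero_add _) (zero_add _), addInv_ofShift,
      addHom_comp_ofShift, oneH_compH])

theorem addInv_addHom (n m : ℤ) (x : A.Obj) :
    compH (zero_add 0) (S.addInv n m x) (S.addHom n m x) = oneH _ :=
  S.hom_ext₂ (zero_add m) (by omega : m + n = n + m) (by
    rw [compH_assoc (zero_add 0) (zero_add m) (zero_add m) (zero_add m),
      compH_assoc (zero_add m) (by omega : m + n = n + m) (by omega) (zero_add _), addHom_ofShift,
      addInv_ofShift, oneH_compH])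

theorem addHom_naturality (n m : ℤ) {x y : A.Obj} (f : A.H x y 0) :
    compH (zero_add 0) (S.map (n + m) f) (S.addHom n m y) =
      compH (zero_add 0) (S.addHom n m x) (S.map m (S.map n f)) :=
  S.hom_ext₂ (zero_add m) (by omega : m + n = n + m) (by
    rw [compH_assoc (zero_add 0) (zero_add m) (zero_add m) (zero_add m),
      compH_assoc (zero_add m) (by omega : m + n = n + m) (by omega) (zero_add _), addHom_ofShift,
      map_ofShift, compH_assoc (zero_add 0) (zero_add m) (zero_add m) (zero_add m), map_ofShift,
      ← compH_assoc (zero_add m) (add_zero m) (add_zero m) (zero_add m),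
      compH_assoc (add_zero m) (zero_add n) (by omega) (by omega), map_ofShift,
      ← compH_assoc (by omega) (add_zero n) (add_zero (n + m)) (by omega), addHom_ofShift])

/-- The shift axioms involve `eqToHom` between shifts by propositionally equal integers; this
removes it after projection. -/
theorem eqToHom_ofShift {n m : ℤ} (h : n = m) (x : A.Obj)
    (e : (⟨S.obj n x⟩ : H0 A) = ⟨S.obj m x⟩) :
    compH (by omega) (show A.H (S.obj n x) (S.obj m x) 0 from eqToHom e) (S.ofShift m x) =
      S.ofShift n x := by
  subst h
  exact oneH_compH _

theorem addHom_assoc (n m l : ℤ) (x : A.Obj)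
    (e : (⟨S.obj (n + m + l) x⟩ : H0 A) = ⟨S.obj (n + (m + l)) x⟩) :
    compH (zero_add 0) (S.addHom (n + m) l x) (S.map l (S.addHom n m x)) =
      compH (zero_add 0)
        (show A.H (S.obj (n + m + l) x) (S.obj (n + (m + l)) x) 0 from eqToHom e)
        (compH (zero_add 0) (S.addHom n (m + l) x) (S.addHom m l (S.obj n x))) := by
  refine S.hom_ext (zero_add l) (S.hom_ext₂ (by omega : l + m = m + l)
    (by omega : m + l + n = n + m + l) ?_)
  rw [compH_assoc (zero_add 0) (zero_add l) (zero_add l) (zero_add l), map_ofShift,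
    ← compH_assoc (zero_add l) (add_zero l) (add_zero l) (zero_add l),
    compH_assoc (add_zero l) (zero_add m) (by omega) (by omega : l + m = m + l),
    compH_assoc (by omega : l + m = m + l) (by omega : m + n = n + m) (by omega) (by omega),
    addHom_ofShift, addHom_ofShift,
    compH_assoc (zero_add 0) (zero_add l) (zero_add l) (zero_add l),
    compH_assoc (zero_add l) (by omega : l + m = m + l) (by omega) (zero_add (m + l)),
    compH_assoc (zero_add 0) (zero_add l) (zero_add l) (zero_add l),
    compH_assoc (zero_add l) (by omega : l + m = m + l) (by omega) (zero_add (m + l)),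
    addHom_ofShift,
    compH_assoc (zero_add (m + l)) (by omega : m + l + n = n + (m + l)) (by omega) (by omega),
    addHom_ofShift, S.eqToHom_ofShift (add_assoc n m l)]

theorem addHom_zero_left (n : ℤ) (x : A.Obj)
    (e : (⟨S.obj (0 + n) x⟩ : H0 A) = ⟨S.obj n x⟩) :
    S.addHom 0 n x =
      compH (zero_add 0) (show A.H (S.obj (0 + n) x) (S.obj n x) 0 from eqToHom e)
        (S.map n (S.toShift 0 x)) := by
  refine S.hom_ext₂ (zero_add n) (by omega : n + 0 = 0 + n) ?_
  rw [addHom_ofShift, compH_assoc (zero_add 0) (zero_add n) (zero_add n) (zero_add n), map_ofShift,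
    compH_assoc (zero_add n) (by omega : n + 0 = 0 + n) (by omega) (by omega),
    compH_assoc (add_zero n) (zero_add 0) (by omega) (by omega : n + 0 = 0 + n)]
  have h := S.toShift_ofShift 0 x
  have h' : compH (by omega : n + 0 = n) (S.ofShift n x)
      (compH (zero_add 0) (S.toShift 0 x) (S.ofShift 0 x)) = S.ofShift n x := by
    erw [h]
    exact compH_oneH _
  -- The intermediate degree equals `n` only propositionally; with a variable in its place it can be
  -- substituted.
  have key : ∀ (a : ℤ) (ha : n + 0 = a) (hb : 0 + a = 0 + n)
    (hc : 0 + n = 0 + n), compH hb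
      (show A.H (S.obj (0 + n) x) (S.obj n x) 0 from eqToHom e) (compH ha (S.ofShift n x)
        (compH (zero_add 0) (S.toShift 0 x) (S.ofShift 0 x))) = S.ofShift (0 + n) x := by
    intro a ha hb hc
    obtain rfl : a = n := by omega
    rw [h']
    exact S.eqToHom_ofShift (zero_add a) x e
  exact (key _ _ _ rfl).symm

theorem addHom_zero_right (n : ℤ) (x : A.Obj)
    (e : (⟨S.obj (n + 0) x⟩ : H0 A) = ⟨S.obj n x⟩) :
    S.addHom n 0 x =
      compH (zero_add 0) (show A.H (S.obj (n + 0) x) (S.obj n x) 0 from eqToHom e)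
        (S.toShift 0 (S.obj n x)) := by
  refine S.hom_ext₂ (zero_add 0) (by omega : 0 + n = n + 0) ?_
  rw [addHom_ofShift, compH_assoc (zero_add 0) (zero_add 0) (zero_add 0) (zero_add 0)]
  have h := S.toShift_ofShift 0 (S.obj n x)
  erw [h]
  rw [compH_assoc (zero_add 0) (by omega : 0 + n = n) (by omega) (by omega), oneH_compH,
    S.eqToHom_ofShift (add_zero n)]

/-- The shift functors on the homotopy category. -/
def functor (n : ℤ) : H0 A ⥤ H0 A where
  obj x := ⟨S.obj n x.obj⟩
  map f := S.map n f
  map_id x := S.map_oneH n x.obj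
  map_comp f g := S.map_compH n f g

/-- The shift by zero is the identity. -/
def zeroIso : S.functor 0 ≅ 𝟭 (H0 A) :=
  NatIso.ofComponents (fun x =>
    { hom := S.ofShift 0 x.obj
      inv := S.toShift 0 x.obj
      hom_inv_id := S.ofShift_toShift 0 x.obj
      inv_hom_id := S.toShift_ofShift 0 x.obj })
    (fun f => S.map_ofShift 0 f)

/-- The compatibility of the shifts with addition. -/
def addIso (n m : ℤ) : S.functor (n + m) ≅ S.functor n ⋙ S.functor m :=
  NatIso.ofComponents (fun x =>
    { hom := S.addHom n m x.obj
      inv := S.addInv n m x.obj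
      hom_inv_id := S.addHom_addInv n m x.obj
      inv_hom_id := S.addInv_addHom n m x.obj })
    (fun f => S.addHom_naturality n m f)

/-- The shifts on the homotopy category. -/
def shiftMkCore : ShiftMkCore (H0 A) ℤ where
  F := S.functor
  zero := S.zeroIso
  add := S.addIso
  assoc_hom_app n m l x := S.addHom_assoc n m l x.obj _
  zero_add_hom_app n x := S.addHom_zero_left n x.obj _
  add_zero_hom_app n x := S.addHom_zero_right n x.obj _

end ShiftData

end DGCat

/-! ### Functors on the homotopy category with values on classes of all degrees. -/

namespace DGCat

variable {k : Type uk} [CommRing k] {A : DGCat.{uk, u, w} k}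

/-- The shifts on the homotopy category. -/
@[reducible]
def ShiftData.hasShift (S : A.ShiftData) : HasShift (H0 A) ℤ := hasShiftMk _ _ S.shiftMkCore

/-- A functor from the homotopy category that is extended to the classes of all degrees. -/
structure ShiftedFunctor (A : DGCat.{uk, u, w} k) (T : Type u') [Category.{v} T] [Preadditive T]
    [HasShift T ℤ] where
  /-- the functor -/
  functor : H0 A ⥤ T
  /-- the extension to classes of all degrees -/
  mapShifted : ∀ {x y : A.Obj} (n : ℤ),
    A.H x y n →+ ShiftedHom (functor.obj ⟨x⟩) (functor.obj ⟨y⟩) n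
  mapShifted_zero : ∀ {x y : A.Obj} (f : A.H x y 0),
    mapShifted 0 f = ShiftedHom.mk₀ 0 rfl (functor.map (homH0 f))
  mapShifted_comp : ∀ {x y z : A.Obj} {n m p : ℤ} (h : n + m = p) (f : A.H x y n)
    (g : A.H y z m),
    mapShifted p (compH h f g) = (mapShifted n f).comp (mapShifted m g) (by omega)

/-- One composite gives a retraction of `f`. The other shows that `g` followed by the shift of `f`
is invertible, so the shift of `f` is epi; the shift functor reflects this, and a split mono that is
epi is an isomorphism. -/
theorem _root_.CategoryTheory.ShiftedHom.isIso_of_comp_eq {T : Type u'} [Category.{v} T]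
    [HasShift T ℤ] {X Y : T} {n m : ℤ} (hn : n + m = 0) (hm : m + n = 0)
    (f : ShiftedHom X Y n) (g : ShiftedHom Y X m)
    (hfg : f.comp g hm = ShiftedHom.mk₀ 0 rfl (𝟙 X))
    (hgf : g.comp f hn = ShiftedHom.mk₀ 0 rfl (𝟙 Y)) : IsIso f := by
  have h₁ : IsSplitMono f := ⟨⟨⟨g⟦n⟧' ≫ (shiftFunctorAdd' T m n 0 hm).inv.app X ≫
      (shiftFunctorZero T ℤ).hom.app X, by
    have e := congrArg (· ≫ (shiftFunctorZero T ℤ).hom.app X) hfg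
    simpa [ShiftedHom.comp, ShiftedHom.mk₀, shiftFunctorZero'] using e⟩⟩⟩
  have h₂ : IsIso (g ≫ (show X ⟶ Y⟦n⟧ from f)⟦m⟧') := by
    have e : g ≫ (show X ⟶ Y⟦n⟧ from f)⟦m⟧' = (shiftFunctorZero T ℤ).inv.app Y ≫
        (shiftFunctorAdd' T n m 0 hn).hom.app Y := by
      rw [← cancel_mono ((shiftFunctorAdd' T n m 0 hn).inv.app Y), Category.assoc, Category.assoc,
        Iso.hom_inv_id_app]
      simpa [ShiftedHom.comp, ShiftedHom.mk₀, shiftFunctorZero'] using hgf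
    rw [e]
    infer_instance
  have h₃ : Epi ((show X ⟶ Y⟦n⟧ from f)⟦m⟧') := epi_of_epi g _
  have h₄ : Epi f := (shiftFunctor T m).epi_of_epi_map h₃
  exact isIso_of_epi_of_isSplitMono f

namespace ShiftedFunctor

variable {T : Type u'} [Category.{v} T] [Preadditive T] [HasShift T ℤ] (F : ShiftedFunctor A T)

theorem mapShifted_comp_left {x y z : A.Obj} {n : ℤ} (f : A.H x y 0) (g : A.H y z n) :
    F.mapShifted n (compH (zero_add n) f g) = F.functor.map (homH0 f) ≫ F.mapShifted n g := by
  rw [F.mapShifted_comp, F.mapShifted_zero, ShiftedHom.mk₀_comp]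

theorem mapShifted_comp_right {x y z : A.Obj} {n : ℤ} (f : A.H x y n) (g : A.H y z 0) :
    F.mapShifted n (compH (add_zero n) f g) =
      F.mapShifted n f ≫ (F.functor.map (homH0 g))⟦n⟧' := by
  rw [F.mapShifted_comp, F.mapShifted_zero, ShiftedHom.comp_mk₀]

theorem isIso_mapShifted {x y : A.Obj} {n m : ℤ} (hn : n + m = 0) (hm : m + n = 0)
    (f : A.H x y n) (g : A.H y x m) (hfg : compH hn f g = oneH x) (hgf : compH hm g f = oneH y) :
    IsIso (F.mapShifted n f) := by
  refine ShiftedHom.isIso_of_comp_eq hn hm _ (F.mapShifted m g) ?_ ?_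
  · rw [← F.mapShifted_comp hn, hfg, F.mapShifted_zero, homH0_oneH, F.functor.map_id]
  · rw [← F.mapShifted_comp hm, hgf, F.mapShifted_zero, homH0_oneH, F.functor.map_id]

/-- The compatibility of the functor with the shift of an object. -/
noncomputable def shiftObjIso (S : A.ShiftData) (n : ℤ) (x : A.Obj) :
    F.functor.obj ⟨S.obj n x⟩ ≅ (F.functor.obj ⟨x⟩)⟦n⟧ :=
  haveI := F.isIso_mapShifted (by omega) (by omega) _ _ (S.ofShift_toShift n x)
      (S.toShift_ofShift n x)
  asIso (F.mapShifted n (S.ofShift n x))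

/-- The compatibility of the functor with the shift by `n`. -/
noncomputable def shiftIso (S : A.ShiftData) (n : ℤ) :
    letI := S.hasShift; shiftFunctor (H0 A) n ⋙ F.functor ≅ F.functor ⋙ shiftFunctor T n :=
  letI := S.hasShift
  NatIso.ofComponents (fun x => F.shiftObjIso S n x.obj) (fun {x y} f => by
    change F.functor.map (homH0 (S.map n f)) ≫ F.mapShifted n (S.ofShift n y.obj) =
      F.mapShifted n (S.ofShift n x.obj) ≫ (F.functor.map (homH0 f))⟦n⟧'
    rw [← mapShifted_comp_left, ← mapShifted_comp_right, S.map_ofShift])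

theorem shiftIso_hom_app (S : A.ShiftData) (n : ℤ) (x : H0 A) :
    letI := S.hasShift
    (F.shiftIso S n).hom.app x = F.mapShifted n (S.ofShift n x.obj) := rfl

/-- The functor commutes with the shifts. -/
@[reducible]
noncomputable def commShift (S : A.ShiftData) : letI := S.hasShift; F.functor.CommShift ℤ :=
  letI := S.hasShift
  { commShiftIso := fun n => F.shiftIso S n
    commShiftIso_zero := by
      ext x
      rw [Functor.CommShift.isoZero_hom_app, shiftIso_hom_app, mapShifted_zero,
        ShiftMkCore.shiftFunctorZero_eq, ShiftedHom.mk₀]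
      simp [shiftFunctorZero']
      rfl
    commShiftIso_add := fun a b => by
      ext x
      rw [Functor.CommShift.isoAdd_hom_app, shiftIso_hom_app, shiftIso_hom_app, shiftIso_hom_app,
        ShiftMkCore.shiftFunctorAdd_eq, ← S.addHom_comp_ofShift, mapShifted_comp_left,
        mapShifted_comp, ShiftedHom.comp, shiftFunctorAdd'_eq_shiftFunctorAdd]
      rfl }

/-- Reconciles the two readings of a class of degree `n`: as a morphism to the chosen shift,
transported by `commShift`, and directly by `mapShifted`. -/
theorem map_lift (S : A.ShiftData) {x y : A.Obj} (n : ℤ) (f : A.H x y n) :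
    letI := S.hasShift
    letI := F.commShift S
    ShiftedHom.map (X := (⟨x⟩ : H0 A)) (Y := ⟨y⟩) (a := n) (S.lift n (zero_add n) f) F.functor =
      F.mapShifted n f := by
  have e := F.mapShifted_comp_left (S.lift n (zero_add n) f) (S.ofShift n y)
  rw [S.lift_ofShift] at e
  exact e.symm

end ShiftedFunctor

/-- The extension of an enhancement to classes of all degrees. -/
def _root_.Enhancement.shiftedFunctor {T : Type u'} [Category.{v} T] [Preadditive T]
    [HasZeroObject T] [HasShift T ℤ] [∀ n : ℤ, (shiftFunctor T n).Additive] [Pretriangulated T]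
    (Φ : Enhancement A T) : ShiftedFunctor A T where
  functor := Φ.functor
  mapShifted := Φ.mapShifted
  mapShifted_zero := Φ.mapShifted_zero
  mapShifted_comp := Φ.mapShifted_comp

end DGCat

/-! ### Exactness of a functor, checked on an enhancement. -/

namespace DGCat

variable {k : Type uk} [CommRing k]

/-- A functor out of an enhanced triangulated category is exact if it lifts to a functor on the
homotopy category of the enhancement that is compatible with the shifts and sends cone triangles to
distinguished triangles. -/
theorem _root_.Enhancement.exists_commShift_isTriangulated {U : Type u} [Category.{v} U]
    [Preadditive U] [HasZeroObject U] [HasShift U ℤ] [∀ n : ℤ, (shiftFunctor U n).Additive]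
    [Pretriangulated U] {A : DGCat.{uk, u', w} k} (Θ : Enhancement A U) {C : Type uC}
    [Category.{vC} C] [Preadditive C]
    [HasZeroObject C] [HasShift C ℤ] [∀ n : ℤ, (shiftFunctor C n).Additive] [Pretriangulated C]
    (Ψ : ShiftedFunctor A C)
    (hΨ : ∀ {x y c : A.Obj} (f : A.Z x y 0) (i : A.H y c 0) (p : A.H c x 1),
      IsConeTriangle f i p → Triangle.mk (Ψ.functor.map (homH0 (cls f)))
        (Ψ.functor.map (homH0 i)) (Ψ.mapShifted 1 p) ∈ distTriang C)
    (G : U ⥤ C) (e : Θ.functor ⋙ G ≅ Ψ.functor) :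
    ∃ _ : G.CommShift ℤ, G.IsTriangulated := by
  let S := Θ.isPretriangulated.shiftData
  let := S.hasShift
  let : Θ.functor.CommShift ℤ := Θ.shiftedFunctor.commShift S
  let : Ψ.functor.CommShift ℤ := Ψ.commShift S
  -- An equivalence is a localization at the isomorphisms. Viewed like this, the compatibility of
  -- `Ψ.functor` with shifts descends along `Θ.functor` to `G`.
  let W : MorphismProperty (H0 A) := MorphismProperty.isomorphisms _
  have : Θ.functor.IsLocalization W := Functor.IsLocalization.of_isEquivalence _ _ le_rfl
  let : Localization.Lifting Θ.functor W Ψ.functor G := ⟨e⟩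
  let : G.CommShift ℤ := Functor.commShiftOfLocalization Θ.functor W ℤ Ψ.functor G
  have : NatTrans.CommShift e.hom ℤ :=
    NatTrans.commShift_iso_hom_of_localization Θ.functor W ℤ Ψ.functor G
  refine ⟨inferInstance, ⟨fun T hT => ?_⟩⟩
  let X := Θ.functor.objPreimage T.obj₁
  let Y := Θ.functor.objPreimage T.obj₂
  -- A distinguished triangle is determined up to isomorphism by its first morphism, so lifting that
  -- morphism and taking its cone replaces `T` by the image of a cone triangle.
  obtain ⟨f, hf⟩ := Θ.functor.map_surjective
    ((Θ.functor.objObjPreimageIso T.obj₁).hom ≫ T.mor₁ ≫ (Θ.functor.objObjPreimageIso T.obj₂).inv)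
  obtain ⟨f, rfl⟩ := cls_surjective (A := A) f
  obtain ⟨c, i, p, h⟩ := Θ.isPretriangulated.exists_cone f
  let φ := isoTriangleOfIso₁₂ _ T (Θ.map_distinguished f i p h) hT
    (Θ.functor.objObjPreimageIso T.obj₁) (Θ.functor.objObjPreimageIso T.obj₂) (by
      change Θ.functor.map (cls f) ≫ _ = _
      rw [hf, Category.assoc, Category.assoc, Iso.inv_hom_id]
      exact congrArg _ (Category.comp_id _))
  refine isomorphic_distinguished _ (hΨ f i p h) _
    (G.mapTriangle.mapIso φ.symm ≪≫ Triangle.isoMk _ _ (e.app _) (e.app _) (e.app _) ?_ ?_ ?_)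
  · exact e.hom.naturality (homH0 (cls f))
  · exact e.hom.naturality (homH0 i)
  · let q : ShiftedHom (⟨c⟩ : H0 A) X (1 : ℤ) := S.lift 1 (zero_add 1) p
    have h₁ := ShiftedHom.map_naturality q e.hom
    have h₂ : q.map Θ.functor = Θ.mapShifted 1 p := Θ.shiftedFunctor.map_lift S 1 p
    have h₃ : q.map Ψ.functor = Ψ.mapShifted 1 p := Ψ.map_lift S 1 p
    rw [ShiftedHom.comp_map, ShiftedHom.comp_mk₀, ShiftedHom.mk₀_comp, h₂, h₃] at h₁
    exact h₁

end DGCat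

/-! ### Triangulated structures inherited along fully faithful functors. -/

namespace CategoryTheory.Functor

variable {U : Type u} [Category.{v} U] [Preadditive U] {T : Type u'} [Category.{v'} T]
  [Preadditive T] [HasZeroObject T] [HasShift T ℤ] [∀ n : ℤ, (shiftFunctor T n).Additive]
  [Pretriangulated T]

/-- A category with a fully faithful additive functor to a triangulated category whose essential
image is a triangulated subcategory inherits a triangulated structure. -/
theorem exists_pretriangulated_of_fullyFaithful (J : U ⥤ T) [J.Full] [J.Faithful] [J.Additive]
    [J.essImage.IsTriangulated] :
    ∃ (_ : HasZeroObject U) (_ : HasShift U ℤ) (_ : ∀ n : ℤ, (shiftFunctor U n).Additive)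
      (_ : Pretriangulated U) (_ : J.CommShift ℤ), J.IsTriangulated := by
  let P := J.essImage
  let hJ := FullyFaithful.ofFullyFaithful J
  -- The essential image is stable under shifts and equivalent to `U`, so its shifts are conjugated
  -- by this equivalence.
  let s (n : ℤ) : U ⥤ U := J.toEssImage ⋙ shiftFunctor P.FullSubcategory n ⋙ J.toEssImage.inv
  let i (n : ℤ) : s n ⋙ J ≅ J ⋙ shiftFunctor T n :=
    isoWhiskerLeft (s n) J.toEssImageCompι.symm ≪≫
      isoWhiskerRight (isoWhiskerLeft (J.toEssImage ⋙ shiftFunctor P.FullSubcategory n)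
        J.toEssImage.asEquivalence.counitIso) P.ι ≪≫
      isoWhiskerLeft J.toEssImage (P.ι.commShiftIso n) ≪≫
      isoWhiskerRight J.toEssImageCompι (shiftFunctor T n)
  let : HasShift U ℤ := hJ.hasShift s i
  let : J.CommShift ℤ := CommShift.ofHasShiftOfFullyFaithful hJ s i
  have hz : HasZeroObject U := by
    obtain ⟨Z, hZ, X, ⟨e⟩⟩ := ObjectProperty.ContainsZero.exists_zero (P := P)
    refine ⟨X, (IsZero.iff_id_eq_zero X).2 (J.map_injective ?_)⟩
    exact (hZ.of_iso e).eq_of_src _ _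
  have ha (n : ℤ) : (shiftFunctor U n).Additive := by
    have : (shiftFunctor U n ⋙ J).Additive := Functor.additive_of_iso (J.commShiftIso n).symm
    exact additive_of_comp_faithful (shiftFunctor U n) J
  let hp : Pretriangulated U :=
    { distinguishedTriangles := J.mapTriangle.obj ⁻¹' (distTriang T)
      isomorphic_distinguished T₁ hT₁ T₂ e :=
        isomorphic_distinguished _ hT₁ _ (J.mapTriangle.mapIso e)
      contractible_distinguished X :=
        isomorphic_distinguished _ (contractible_distinguished (J.obj X)) _
          (Triangle.isoMk _ _ (Iso.refl _) (Iso.refl _) J.mapZeroObject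
            (by
              change J.map (𝟙 X) ≫ 𝟙 _ = 𝟙 _ ≫ 𝟙 _
              rw [J.map_id])
            ((isZero_zero T).eq_of_tgt _ _)
            (((isZero_zero T).of_iso J.mapZeroObject).eq_of_src _ _))
      distinguished_cocone_triangle {X Y} f := by
        obtain ⟨Z', g', h', mem⟩ := distinguished_cocone_triangle (J.map f)
        -- The only axiom that needs closure of the essential image under cones: the third vertex
        -- has to come from `U`.
        obtain ⟨Z'', e⟩ : P Z' := P.ext_of_isTriangulatedClosed₃ _ mem
          (J.obj_mem_essImage X) (J.obj_mem_essImage Y)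
        obtain ⟨e⟩ := e
        exact ⟨Z'', hJ.preimage (g' ≫ e.inv),
          hJ.preimage (e.hom ≫ h' ≫ (J.commShiftIso (1 : ℤ)).inv.app X),
          isomorphic_distinguished _ mem _
            (Triangle.isoMk _ _ (Iso.refl _) (Iso.refl _) e
              ((Category.comp_id _).trans (Category.id_comp _).symm)
              (by
                change J.map (hJ.preimage (g' ≫ e.inv)) ≫ e.hom = 𝟙 _ ≫ g'
                rw [hJ.map_preimage, Category.assoc, e.inv_hom_id, Category.comp_id,
                  Category.id_comp])
              (by
                change (J.map (hJ.preimage (e.hom ≫ h' ≫ (J.commShiftIso (1 : ℤ)).inv.app X)) ≫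
                  (J.commShiftIso (1 : ℤ)).hom.app X) ≫ (𝟙 (J.obj X))⟦(1 : ℤ)⟧' = e.hom ≫ h'
                rw [hJ.map_preimage, Functor.map_id]
                refine (Category.comp_id _).trans ?_
                rw [Category.assoc, Category.assoc, Iso.inv_hom_id_app]
                exact congrArg _ (Category.comp_id _)))⟩
      rotate_distinguished_triangle T :=
        (rotate_distinguished_triangle (J.mapTriangle.obj T)).trans
          (distinguished_iff_of_iso (J.mapTriangleRotateIso.app T))
      complete_distinguished_triangle_morphism T₁ T₂ hT₁ hT₂ a b comm := by
        obtain ⟨c, ⟨hc₁, hc₂⟩⟩ := complete_distinguished_triangle_morphism (J.mapTriangle.obj T₁)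
          (J.mapTriangle.obj T₂) hT₁ hT₂ (J.map a) (J.map b)
          (by
            change J.map T₁.mor₁ ≫ J.map b = J.map a ≫ J.map T₂.mor₁
            rw [← J.map_comp, comm, J.map_comp])
        obtain ⟨c, rfl⟩ := J.map_surjective (X := T₁.obj₃) (Y := T₂.obj₃) c
        refine ⟨c, J.map_injective ?_, J.map_injective ?_⟩
        · rw [J.map_comp, J.map_comp]
          exact hc₁
        · have h : (J.map T₁.mor₃ ≫ (J.commShiftIso (1 : ℤ)).hom.app T₁.obj₁) ≫
            (J.map a)⟦(1 : ℤ)⟧' =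
              J.map c ≫ J.map T₂.mor₃ ≫ (J.commShiftIso (1 : ℤ)).hom.app T₂.obj₁ := hc₂
          rw [← cancel_mono ((J.commShiftIso (1 : ℤ)).hom.app T₂.obj₁), J.map_comp, J.map_comp,
            Category.assoc, Category.assoc, ← h, Category.assoc,
            J.commShiftIso_hom_naturality] }
  exact ⟨hz, inferInstance, ha, hp, inferInstance, ⟨fun _ hT => hT⟩⟩

end CategoryTheory.Functor

/-! ### Closure of `G.Q` under zero objects, shifts and cones. -/

namespace DGCat

variable {k : Type uk} [CommRing k] {A : DGCat.{uk, u, w} k} {E : DGCat.{uk, u', w'} k}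

theorem isZero_of_oneH_eq_zero {x : A.Obj} (h : oneH x = 0) : IsZero (⟨x⟩ : H0 A) :=
  (IsZero.iff_id_eq_zero _).2 h

/-- An invertible class of degree zero gives an isomorphism of the homotopy category. -/
def isoOfH {x y : A.Obj} (f : A.H x y 0) (g : A.H y x 0)
    (h₁ : compH (zero_add 0) f g = oneH x) (h₂ : compH (zero_add 0) g f = oneH y) :
    (⟨x⟩ : H0 A) ≅ ⟨y⟩ := ⟨f, g, h₁, h₂⟩

section

variable {P : DGCat.{uk, u'', w''} k} {L : DGFunctor A P} {K : DGFunctor E P}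

theorem _root_.DGFunctor.IsFullyFaithful.exists_comm (hL : L.IsFullyFaithful) {x y : E.Obj}
    {a b : A.Obj}
    (u : (⟨K.obj x⟩ : H0 P) ≅ ⟨L.obj a⟩) (v : (⟨K.obj y⟩ : H0 P) ≅ ⟨L.obj b⟩) (f : E.Z x y 0) :
    ∃ f' : A.Z a b 0, compH (zero_add 0) u.hom (cls (L.mapZ f')) =
      compH (zero_add 0) (cls (K.mapZ f)) v.hom := by
  obtain ⟨f', hf'⟩ := (hL.mapH_bijective _ _ _).2 (u.inv ≫ homH0 (K.mapH (cls f)) ≫ v.hom)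
  obtain ⟨f', rfl⟩ := cls_surjective f'
  refine ⟨f', ?_⟩
  change u.hom ≫ L.mapH (cls f') = homH0 (K.mapH (cls f)) ≫ v.hom
  rw [hf']
  exact u.hom_inv_id_assoc _

/-- Both DG functors preserve cones up to homotopy, and in `P` cones of isomorphic morphisms are
isomorphic. This compares cones formed in `E` with cones formed in `A`. -/
theorem IsHomotopyCone.exists_iso_map {x y c : E.Obj} {f : E.Z x y 0} {i : E.H y c 0}
    {p : E.H c x 1} (h : IsHomotopyCone f i p) {a b d : A.Obj} {f' : A.Z a b 0} {i' : A.H b d 0}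
    {p' : A.H d a 1} (h' : IsHomotopyCone f' i' p') (u : (⟨K.obj x⟩ : H0 P) ≅ ⟨L.obj a⟩)
    (v : (⟨K.obj y⟩ : H0 P) ≅ ⟨L.obj b⟩)
    (hf : compH (zero_add 0) u.hom (cls (L.mapZ f')) =
      compH (zero_add 0) (cls (K.mapZ f)) v.hom) :
    ∃ φ : (⟨K.obj c⟩ : H0 P) ≅ ⟨L.obj d⟩,
      compH (zero_add 0) (K.mapH i) φ.hom = compH (zero_add 0) v.hom (L.mapH i') ∧
      compH (zero_add 1) φ.hom (L.mapH p') = compH (add_zero 1) (K.mapH p) u.hom := by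
  obtain ⟨φ, hφ, h₁, h₂⟩ := (h.map K).exists_iso (h'.map L) u.hom v.hom
    (inferInstanceAs (IsIso u.hom)) (inferInstanceAs (IsIso v.hom)) hf
  exact ⟨asIso (homH0 φ), h₁, h₂⟩

end

section

variable (G : DGFunctor E A.Perf)

/-- The objects that `G` sends to the image of `A`, up to homotopy equivalence. -/
abbrev IsQ (e : E.Obj) : Prop :=
  ∃ a : A.Obj, Nonempty ((⟨G.obj e⟩ : H0 A.Perf) ≅ ⟨A.toPerf.obj a⟩)

variable {G}

theorem isQ_of_oneH_eq_zero (hA : A.IsPretriangulated) {e : E.Obj} (he : oneH e = 0) : IsQ G e := by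
  obtain ⟨a, ha⟩ := hA.exists_zero
  have h₁ : oneH (G.obj e) = 0 := by rw [← G.mapH_oneH, he, map_zero]
  have h₂ : oneH (A.toPerf.obj a) = 0 := by rw [← A.toPerf.mapH_oneH, ha, map_zero]
  exact ⟨a, ⟨(isZero_of_oneH_eq_zero h₁).iso (isZero_of_oneH_eq_zero h₂)⟩⟩

/-- The classes `s` and `t` make `y` a shift of `x`. Then `G y` is a shift of the image of `a`, as
is the image of the shift of `a` taken in `A`. -/
theorem IsQ.of_comp_eq (hA : A.IsPretriangulated) {x y : E.Obj} (hx : IsQ G x) {n m : ℤ}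
    (h₁ : n + m = 0) (h₂ : m + n = 0) (s : E.H x y n) (t : E.H y x m)
    (hst : compH h₁ s t = oneH x) (hts : compH h₂ t s = oneH y) : IsQ G y := by
  obtain rfl : n = -m := by omega
  obtain ⟨a, ⟨θ⟩⟩ := hx
  obtain ⟨b, s', t', hst', hts'⟩ := hA.exists_shift a m
  -- Stated for two arbitrary shifts because it is used twice, with their roles exchanged, for the
  -- two composites of the isomorphism.
  have key : ∀ {X Y X' Y' : A.Perf.Obj} (s : A.Perf.H X Y (-m)) (t : A.Perf.H Y X m)
    (hts : compH h₂ t s = oneH Y) (s' : A.Perf.H X' Y' (-m)) (t' : A.Perf.H Y' X' m)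
    (hst' : compH h₁ s' t' = oneH X') (f : A.Perf.H X X' 0) (g : A.Perf.H X' X 0)
    (hfg : compH (zero_add 0) f g = oneH X), compH (zero_add 0)
      (compH h₂ t (compH (zero_add (-m)) f s'))
      (compH h₂ t' (compH (zero_add (-m)) g s)) = oneH Y := by
    intro X Y X' Y' s t hts s' t' hst' f g hfg
    rw [compH_assoc h₂ (add_zero (-m)) (zero_add 0) h₂,
      compH_assoc (zero_add (-m)) (add_zero (-m)) (add_zero (-m)) (zero_add (-m)),
      ← compH_assoc h₁ h₂ (zero_add (-m)) (add_zero (-m)), hst',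
      oneH_compH, ← compH_assoc (zero_add 0) (zero_add (-m)) (zero_add (-m)) (zero_add (-m)), hfg,
      oneH_compH, hts]
  have e₁ : compH h₁ (G.mapH s) (G.mapH t) = oneH (G.obj x) := by
    rw [← G.mapH_compH, hst, G.mapH_oneH]
  have e₂ : compH h₂ (G.mapH t) (G.mapH s) = oneH (G.obj y) := by
    rw [← G.mapH_compH, hts, G.mapH_oneH]
  have e₃ : compH h₁ (A.toPerf.mapH s') (A.toPerf.mapH t') = oneH (A.toPerf.obj a) := by
    rw [← A.toPerf.mapH_compH, hst', A.toPerf.mapH_oneH]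
  have e₄ : compH h₂ (A.toPerf.mapH t') (A.toPerf.mapH s') = oneH (A.toPerf.obj b) := by
    rw [← A.toPerf.mapH_compH, hts', A.toPerf.mapH_oneH]
  exact ⟨b, ⟨isoOfH _ _ (key _ _ e₂ _ _ e₃ θ.hom θ.inv θ.hom_inv_id)
    (key _ _ e₄ _ _ e₁ θ.inv θ.hom θ.inv_hom_id)⟩⟩

/-- The image of `f` comes from a morphism of `A`, whose cone in `A` provides the required object.
-/
theorem IsQ.cone (hA : A.IsPretriangulated) {x y c : E.Obj} {f : E.Z x y 0} {i : E.H y c 0}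
    {p : E.H c x 1} (h : IsHomotopyCone f i p) (hx : IsQ G x) (hy : IsQ G y) : IsQ G c := by
  obtain ⟨a, ⟨u⟩⟩ := hx
  obtain ⟨b, ⟨v⟩⟩ := hy
  obtain ⟨f', hf'⟩ := A.toPerf_isFullyFaithful.exists_comm u v f
  obtain ⟨d, i', p', h'⟩ := hA.exists_cone f'
  exact ⟨d, ⟨(h.exists_iso_map h'.isHomotopyCone u v hf').choose⟩⟩

theorem isPretriangulated_Q (hA : A.IsPretriangulated) (hE : E.IsPretriangulated) :
    G.Q.IsPretriangulated where
  exists_zero := by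
    obtain ⟨z, hz⟩ := hE.exists_zero
    exact ⟨⟨z, isQ_of_oneH_eq_zero hA hz⟩, hz⟩
  exists_shift x n := by
    obtain ⟨y, s, t, h₁, h₂⟩ := hE.exists_shift x.1 n
    exact ⟨⟨y, IsQ.of_comp_eq hA x.2 _ _ s t h₁ h₂⟩, s, t, h₁, h₂⟩
  exists_cone {x y} f := by
    obtain ⟨c, i, p, h⟩ := hE.exists_cone (x := x.1) (y := y.1) f
    exact ⟨⟨c, IsQ.cone hA h.isHomotopyCone x.2 y.2⟩, i, p, h.full _ x.2 y.2 _⟩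

end

end DGCat

/-! ### Enhancements send cones up to homotopy to distinguished triangles. -/

namespace Enhancement

variable {k : Type uk} [CommRing k] {A : DGCat.{uk, u, w} k} {T : Type u'} [Category.{v} T]
  [Preadditive T] [HasZeroObject T] [HasShift T ℤ] [∀ n : ℤ, (shiftFunctor T n).Additive]
  [Pretriangulated T] (Φ : Enhancement A T)

theorem distinguished_of_isConeTriangle_of_isIso {x y c c' : A.Obj} {f : A.Z x y 0}
    {i : A.H y c 0} {p : A.H c x 1} {i' : A.H y c' 0} {p' : A.H c' x 1}
    (h : DGCat.IsConeTriangle f i' p') (φ : A.H c c' 0) [IsIso (DGCat.homH0 φ)]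
    (h₁ : DGCat.compH (zero_add 0) i φ = i') (h₂ : DGCat.compH (zero_add 1) φ p' = p) :
    Triangle.mk (Φ.functor.map (DGCat.homH0 (DGCat.cls f))) (Φ.functor.map (DGCat.homH0 i))
      (Φ.mapShifted 1 p) ∈ distTriang T := by
  refine isomorphic_distinguished _ (Φ.map_distinguished f i' p' h) _
    (Triangle.isoMk _ _ (Iso.refl _) (Iso.refl _)
      (Φ.functor.mapIso (asIso (DGCat.homH0 φ))) ?_ ?_ ?_)
  · exact (Category.comp_id _).trans (Category.id_comp _).symm
  · refine Eq.trans ?_ (Category.id_comp _).symm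
    exact (Φ.functor.map_comp (DGCat.homH0 i) (DGCat.homH0 φ)).symm.trans
      (congrArg Φ.functor.map h₁)
  · change Φ.mapShifted 1 p ≫ (𝟙 (Φ.functor.obj ⟨x⟩))⟦(1 : ℤ)⟧' =
      Φ.functor.map (DGCat.homH0 φ) ≫ Φ.mapShifted 1 p'
    refine Eq.trans ?_ (Φ.shiftedFunctor.mapShifted_comp_left φ p')
    rw [h₂]
    exact (congrArg (Φ.mapShifted 1 p ≫ ·) (CategoryTheory.Functor.map_id _ _)).trans
      (Category.comp_id _)

/-- By uniqueness of cones the triangle is isomorphic to a cone triangle on the same `f`, for which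
the conclusion is part of an enhancement. This is needed because a DG functor sends cone triangles
only to cones up to homotopy. -/
theorem distinguished_of_isHomotopyCone {x y c : A.Obj} {f : A.Z x y 0} {i : A.H y c 0}
    {p : A.H c x 1} (h : DGCat.IsHomotopyCone f i p) :
    Triangle.mk (Φ.functor.map (DGCat.homH0 (DGCat.cls f))) (Φ.functor.map (DGCat.homH0 i))
      (Φ.mapShifted 1 p) ∈ distTriang T := by
  obtain ⟨c', i', p', h'⟩ := Φ.isPretriangulated.exists_cone f
  obtain ⟨φ, hφ, h₁, h₂⟩ := h.exists_iso h'.isHomotopyCone (DGCat.oneH x) (DGCat.oneH y)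
    (inferInstanceAs (IsIso (𝟙 (⟨x⟩ : DGCat.H0 A))))
    (inferInstanceAs (IsIso (𝟙 (⟨y⟩ : DGCat.H0 A))))
    ((DGCat.oneH_compH _).trans (DGCat.compH_oneH _).symm)
  exact Φ.distinguished_of_isConeTriangle_of_isIso h' φ (h₁.trans (DGCat.oneH_compH _))
    (h₂.trans (DGCat.compH_oneH _))

end Enhancement

/-! ### Transport, restriction and lifting of functors extended to all degrees. -/

namespace DGCat.ShiftedFunctor

variable {k : Type uk} [CommRing k] {A : DGCat.{uk, u, w} k} {T : Type u'} [Category.{v} T]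
  [Preadditive T] [HasShift T ℤ]

/-- Replace the underlying functor by an isomorphic one. -/
def ofIso (Ψ : ShiftedFunctor A T) (F : H0 A ⥤ T) (e : F ≅ Ψ.functor) : ShiftedFunctor A T where
  functor := F
  mapShifted {x y} n :=
    { toFun := fun f => e.hom.app ⟨x⟩ ≫ Ψ.mapShifted n f ≫ (e.inv.app ⟨y⟩)⟦n⟧'
      map_zero' := by rw [map_zero]; simp
      map_add' := fun f g => by rw [map_add]; simp }
  mapShifted_zero {x y} f := by
    change e.hom.app ⟨x⟩ ≫ Ψ.mapShifted 0 f ≫ (e.inv.app ⟨y⟩)⟦(0 : ℤ)⟧' = _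
    rw [Ψ.mapShifted_zero, ← ShiftedHom.comp_mk₀ _ 0 rfl, ← ShiftedHom.mk₀_comp 0 rfl,
      ShiftedHom.mk₀_comp_mk₀, ShiftedHom.mk₀_comp_mk₀, NatIso.naturality_2]
  mapShifted_comp {x y z n m p} h f g := by
    change e.hom.app ⟨x⟩ ≫ Ψ.mapShifted p (compH h f g) ≫ (e.inv.app ⟨z⟩)⟦p⟧' =
      ShiftedHom.comp (e.hom.app ⟨x⟩ ≫ Ψ.mapShifted n f ≫ (e.inv.app ⟨y⟩)⟦n⟧')
        (e.hom.app ⟨y⟩ ≫ Ψ.mapShifted m g ≫ (e.inv.app ⟨z⟩)⟦m⟧') _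
    rw [Ψ.mapShifted_comp]
    simp only [ShiftedHom.comp, Functor.map_comp, Category.assoc]
    rw [← Functor.map_comp_assoc (shiftFunctor T n), Iso.inv_hom_id_app,
      CategoryTheory.Functor.map_id, Category.id_comp]
    exact congrArg (fun t => e.hom.app ⟨x⟩ ≫ Ψ.mapShifted n f ≫ (Ψ.mapShifted m g)⟦n⟧' ≫ t)
      ((shiftFunctorAdd' T m n p (by omega)).inv.naturality (e.inv.app ⟨z⟩)).symm

theorem ofIso_mapShifted_comp (Ψ : ShiftedFunctor A T) {F : H0 A ⥤ T} (e : F ≅ Ψ.functor)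
    {x y : A.Obj} {n : ℤ} (f : A.H x y n) :
    (Ψ.ofIso F e).mapShifted n f ≫ (e.hom.app ⟨y⟩)⟦n⟧' = e.hom.app ⟨x⟩ ≫ Ψ.mapShifted n f := by
  change (e.hom.app ⟨x⟩ ≫ Ψ.mapShifted n f ≫ (e.inv.app ⟨y⟩)⟦n⟧') ≫ (e.hom.app ⟨y⟩)⟦n⟧' = _
  rw [Category.assoc, Category.assoc, ← Functor.map_comp, Iso.inv_hom_id_app,
    CategoryTheory.Functor.map_id, Category.comp_id]

/-- Precompose with a DG functor. -/
def precomp {B : DGCat.{uk, uC, vC} k} (F : DGFunctor B A) (Ψ : ShiftedFunctor A T) :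
    ShiftedFunctor B T where
  functor := F.mapH0 ⋙ Ψ.functor
  mapShifted n := (Ψ.mapShifted n).comp F.mapH.toAddMonoidHom
  mapShifted_zero f := Ψ.mapShifted_zero (F.mapH f)
  mapShifted_comp h f g := by
    change Ψ.mapShifted _ (F.mapH (compH h f g)) = _
    rw [F.mapH_compH, Ψ.mapShifted_comp]
    rfl

/-- Lift along a fully faithful functor that commutes with the shifts. -/
noncomputable def lift {U : Type uC} [Category.{vC} U] [Preadditive U] [HasShift U ℤ] (J : U ⥤ T)
    [J.Full] [J.Faithful] [J.Additive] [J.CommShift ℤ] (Ψ : ShiftedFunctor A T) (Θ : H0 A ⥤ U)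
    (e : Θ ⋙ J ≅ Ψ.functor) : ShiftedFunctor A U :=
  let g {x y : A.Obj} (n : ℤ) (f : A.H x y n) : ShiftedHom (Θ.obj ⟨x⟩) (Θ.obj ⟨y⟩) n :=
    J.preimage (((Ψ.ofIso _ e).mapShifted n f : J.obj _ ⟶ _) ≫
        (J.commShiftIso n).inv.app (Θ.obj ⟨y⟩))
  have hg {x y : A.Obj} (n : ℤ) (f : A.H x y n) : (g n f).map J = (Ψ.ofIso _ e).mapShifted n f := by
    rw [ShiftedHom.map, J.map_preimage]
    exact (Category.assoc _ _ _).trans ((congrArg _ (Iso.inv_hom_id_app _ _)).trans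
      (Category.comp_id _))
  -- Since `J` is faithful, each identity may be checked after applying it, where it is the one for
  -- `Ψ.ofIso`.
  have inj {X Y : U} {n : ℤ} {f f' : ShiftedHom X Y n} (h : f.map J = f'.map J) : f = f' :=
    J.map_injective ((cancel_mono _).1 h)
  { functor := Θ
    mapShifted := fun {x y} n =>
      { toFun := g n
        map_zero' := inj (by rw [hg, map_zero, ShiftedHom.map_zero]; rfl)
        map_add' := fun f f' => inj (by rw [hg, map_add, ShiftedHom.map_add, hg, hg]; rfl) }
    mapShifted_zero := fun f => inj (by
      rw [ShiftedHom.map_mk₀]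
      exact (hg 0 f).trans ((Ψ.ofIso _ e).mapShifted_zero f))
    mapShifted_comp := fun {x y z n m p} h f f' => inj (by
      rw [ShiftedHom.map_comp]
      refine (hg p _).trans (((Ψ.ofIso _ e).mapShifted_comp h f f').trans ?_)
      rw [← hg, ← hg]
      rfl) }

theorem lift_mapShifted_map {U : Type uC} [Category.{vC} U] [Preadditive U] [HasShift U ℤ]
    (J : U ⥤ T) [J.Full] [J.Faithful] [J.Additive] [J.CommShift ℤ] (Ψ : ShiftedFunctor A T)
    (Θ : H0 A ⥤ U) (e : Θ ⋙ J ≅ Ψ.functor) {x y : A.Obj} (n : ℤ) (f : A.H x y n) :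
    ShiftedHom.map ((Ψ.lift J Θ e).mapShifted n f) J = (Ψ.ofIso _ e).mapShifted n f := by
  refine (congrArg (· ≫ _) (J.map_preimage (X := Θ.obj ⟨x⟩) (Y := (Θ.obj ⟨y⟩)⟦n⟧) _)).trans ?_
  exact (Category.assoc _ _ _).trans ((congrArg _ (Iso.inv_hom_id_app _ _)).trans
    (Category.comp_id _))

end DGCat.ShiftedFunctor

/-! ### Modules over a monad and over its extension to the idempotent completion. -/

namespace CategoryTheory

section

variable {C : Type u} [Category.{v} C] {D : Type u'} [Category.{v'} D]

instance functorExtension₂_obj_faithful (F : C ⥤ D) [F.Faithful] :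
    ((functorExtension₂ C D).obj F).Faithful where
  map_injective h :=
    Karoubi.hom_ext _ _ (F.map_injective (congrArg Karoubi.Hom.f h))

instance functorExtension₂_obj_full (F : C ⥤ D) [F.Full] [F.Faithful] :
    ((functorExtension₂ C D).obj F).Full where
  map_surjective {X Y} f := by
    obtain ⟨g, hg⟩ := F.map_surjective (X := X.X) (Y := Y.X) f.f
    refine ⟨⟨g, F.map_injective ?_⟩, Karoubi.hom_ext _ _ hg⟩
    rw [F.map_comp, F.map_comp, hg]
    exact f.comm

/-- Transport of an algebra over a monad along an isomorphism. -/
def Monad.Algebra.ofIso {K : Monad C} (t : K.Algebra) {x : C} (e : x ≅ t.A) : K.Algebra where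
  A := x
  a := K.map e.hom ≫ t.a ≫ e.inv
  unit := by
    have h : e.hom ≫ K.η.app t.A = K.η.app x ≫ K.map e.hom := K.η.naturality e.hom
    rw [← Category.assoc, ← h, Category.assoc, t.unit_assoc, e.hom_inv_id]
  assoc := by
    have h : K.map (K.map e.hom) ≫ K.μ.app t.A = K.μ.app x ≫ K.map e.hom :=
      K.μ.naturality e.hom
    rw [← Category.assoc, ← h, Category.assoc, t.assoc_assoc]
    simp only [Functor.map_comp, Category.assoc]
    rw [← K.map_comp_assoc e.inv, e.inv_hom_id, CategoryTheory.Functor.map_id, Category.id_comp]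

/-- The isomorphism between an algebra and its transport. -/
def Monad.Algebra.ofIsoIso {K : Monad C} (t : K.Algebra) {x : C} (e : x ≅ t.A) : t.ofIso e ≅ t :=
  Monad.Algebra.isoMk e (by simp [Monad.Algebra.ofIso])

end

section

variable {C : Type u} [Category.{v} C] (M : Monad C)

/-- The functor from modules over a monad to modules over its extension to the idempotent
completion. -/
def karoubiAlgebra : M.Algebra ⥤ (karoubiMonad M).Algebra where
  obj X :=
    { A := (toKaroubi C).obj X.A
      a := ⟨X.a, by
        change M.map (𝟙 X.A) ≫ X.a ≫ 𝟙 X.A = X.a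
        rw [CategoryTheory.Functor.map_id, Category.id_comp, Category.comp_id]⟩
      unit := Karoubi.hom_ext _ _ (by
        change (𝟙 X.A ≫ M.η.app X.A) ≫ X.a = 𝟙 X.A
        rw [Category.id_comp, X.unit])
      assoc := Karoubi.hom_ext _ _ (by
        change (M.map (M.map (𝟙 X.A)) ≫ M.μ.app X.A) ≫ X.a = M.map X.a ≫ X.a
        rw [CategoryTheory.Functor.map_id, CategoryTheory.Functor.map_id, Category.id_comp,
          X.assoc]) }
  map f :=
    { f := (toKaroubi C).map f.f
      h := Karoubi.hom_ext _ _ f.h }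
  map_id _ := rfl
  map_comp _ _ := rfl

instance : (karoubiAlgebra M).Faithful where
  map_injective {X Y _ _} h := Monad.Algebra.Hom.ext
    (congrArg (fun t : (karoubiAlgebra M).obj X ⟶ (karoubiAlgebra M).obj Y => t.f.f) h)

instance : (karoubiAlgebra M).Full where
  map_surjective f := ⟨⟨f.f.f, congrArg Karoubi.Hom.f f.h⟩, rfl⟩

instance [Preadditive C] [M.toFunctor.Additive] : (karoubiAlgebra M).Additive where
  map_add := rfl

/-- The module structure can be transported along the isomorphism of underlying objects. On an
object whose idempotent is the identity, the action is an ordinary morphism of `C`, and the module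
axioms become those over `M`. -/
theorem essImage_karoubiAlgebra_iff (t : (karoubiMonad M).Algebra) :
    (karoubiAlgebra M).essImage t ↔ (toKaroubi C).essImage t.A := by
  constructor
  · rintro ⟨X, ⟨e⟩⟩
    exact ⟨X.A, ⟨(karoubiMonad M).forget.mapIso e⟩⟩
  · rintro ⟨x, ⟨e⟩⟩
    refine Functor.essImage.ofIso (t.ofIsoIso e) ?_
    let s : (karoubiMonad M).Algebra := t.ofIso e
    let a : (karoubiMonad M).obj ((toKaroubi C).obj x) ⟶ (toKaroubi C).obj x := s.a
    refine ⟨{ A := x, a := a.f, unit := ?_, assoc := ?_ },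
      ⟨Monad.Algebra.isoMk (Iso.refl _) ?_⟩⟩
    · have h : (𝟙 x ≫ M.η.app x) ≫ a.f = 𝟙 x := congrArg Karoubi.Hom.f s.unit
      rwa [Category.id_comp] at h
    · have h : (M.map (M.map (𝟙 x)) ≫ M.μ.app x) ≫ a.f = M.map a.f ≫ a.f :=
        congrArg Karoubi.Hom.f s.assoc
      rwa [CategoryTheory.Functor.map_id, CategoryTheory.Functor.map_id, Category.id_comp] at h
    · change (karoubiMonad M).map (𝟙 ((toKaroubi C).obj x)) ≫ s.a = a ≫ 𝟙 _
      rw [CategoryTheory.Functor.map_id]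
      exact (Category.id_comp _).trans (Category.comp_id _).symm

end

end CategoryTheory

namespace Enhancement

variable {k : Type uk} [CommRing k] {A : DGCat.{uk, u, w} k} {C : Type u'} [Category.{v} C]
  [Preadditive C] [HasZeroObject C] [HasShift C ℤ] [∀ n : ℤ, (shiftFunctor C n).Additive]
  [Pretriangulated C] (ε : Enhancement A C)

instance : A.toPerf.mapH0.Full := A.toPerf_isFullyFaithful.full_mapH0

instance : A.toPerf.mapH0.Faithful := A.toPerf_isFullyFaithful.faithful_mapH0

instance : ε.karoubiToPerf.Full :=
  inferInstanceAs ((functorExtension₂ C (DGCat.H0 A.Perf)).obj _).Full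

instance : ε.karoubiToPerf.Faithful :=
  inferInstanceAs ((functorExtension₂ C (DGCat.H0 A.Perf)).obj _).Faithful

/-- The functor `karoubiToPerf` extends the Yoneda embedding. -/
noncomputable def functorCompKaroubiToPerf :
    ε.functor ⋙ toKaroubi C ⋙ ε.karoubiToPerf ≅ A.toPerf.mapH0 ⋙ toKaroubi _ :=
  Functor.isoWhiskerLeft ε.functor
      ((functorExtension₂CompWhiskeringLeftToKaroubiIso C (DGCat.H0 A.Perf)).app
        (ε.functor.inv ⋙ A.toPerf.mapH0)) ≪≫
    Functor.isoWhiskerRight ε.functor.asEquivalence.unitIso.symm (A.toPerf.mapH0 ⋙ toKaroubi _)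

/-- Being in the image of `C` is tested after the fully faithful functor `karoubiToPerf`, which
matches the image of `C` with the image of `A`; isomorphisms then descend along the fully faithful
`toKaroubi`. -/
theorem isQ_iff {M : Monad C} {E : DGCat.{uk, uC, w'} k} (G : DGFunctor E A.Perf)
    (Φ : DGCat.H0 E ⥤ (karoubiMonad M).Algebra)
    (hG : G.mapH0 ⋙ toKaroubi (DGCat.H0 A.Perf) ≅
      Φ ⋙ (karoubiMonad M).forget ⋙ ε.karoubiToPerf) (e : E.Obj) :
    DGCat.IsQ G e ↔ (karoubiAlgebra M).essImage (Φ.obj ⟨e⟩) := by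
  rw [essImage_karoubiAlgebra_iff]
  constructor
  · rintro ⟨a, ⟨θ⟩⟩
    exact ⟨ε.functor.obj ⟨a⟩, ⟨ε.karoubiToPerf.preimageIso
      (ε.functorCompKaroubiToPerf.app ⟨a⟩ ≪≫ (toKaroubi _).mapIso θ.symm ≪≫ hG.app ⟨e⟩)⟩⟩
  · rintro ⟨c, ⟨θ⟩⟩
    refine ⟨(ε.functor.objPreimage c).obj, ⟨(toKaroubi _).preimageIso
      (hG.app ⟨e⟩ ≪≫ ε.karoubiToPerf.mapIso (θ.symm ≪≫
        (toKaroubi C).mapIso (ε.functor.objObjPreimageIso c).symm) ≪≫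
        ε.functorCompKaroubiToPerf.app _)⟩⟩

end Enhancement

/-! ### Lifting a DG functor through a fully faithful one, on cohomology. -/

namespace DGCat

variable {k : Type uk} [CommRing k] {A : DGCat.{uk, u, w} k} {B : DGCat.{uk, u', w'} k}
  {P : DGCat.{uk, u'', w''} k} {L : DGFunctor A P} (hL : L.IsFullyFaithful) (K : DGFunctor B P)
  (a : B.Obj → A.Obj) (θ : ∀ x, (⟨K.obj x⟩ : H0 P) ≅ ⟨L.obj (a x)⟩)

/-- A DG functor that takes values in the image of a fully faithful DG functor up to homotopy
equivalence, on cohomology classes. -/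
noncomputable def liftH {x y : B.Obj} (n : ℤ) : B.H x y n →ₗ[k] A.H (a x) (a y) n :=
  (LinearEquiv.ofBijective _ (hL.mapH_bijective (a x) (a y) n)).symm ∘ₗ
    compH (zero_add n) (θ x).inv ∘ₗ (compH (add_zero n)).flip (θ y).hom ∘ₗ K.mapH

theorem mapH_liftH {x y : B.Obj} {n : ℤ} (f : B.H x y n) :
    L.mapH (liftH hL K a θ n f) =
      compH (zero_add n) (θ x).inv (compH (add_zero n) (K.mapH f) (θ y).hom) :=
  LinearEquiv.apply_symm_apply (LinearEquiv.ofBijective _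
    (hL.mapH_bijective (a x) (a y) n)) _

theorem hom_comp_mapH_liftH {x y : B.Obj} {n : ℤ} (f : B.H x y n) :
    compH (zero_add n) (θ x).hom (L.mapH (liftH hL K a θ n f)) =
      compH (add_zero n) (K.mapH f) (θ y).hom := by
  have h : compH (zero_add 0) (θ x).hom (θ x).inv = oneH (K.obj x) := (θ x).hom_inv_id
  rw [mapH_liftH, ← compH_assoc (zero_add 0) (zero_add n) (zero_add n) (zero_add n), h,
    oneH_compH]

/-- As `θ x` is invertible and `L` is injective on cohomology, compatibility with `θ` characterises
the lift; its functoriality follows from this. -/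
theorem liftH_eq_iff {x y : B.Obj} {n : ℤ} (f : B.H x y n) (g : A.H (a x) (a y) n) :
    liftH hL K a θ n f = g ↔ compH (zero_add n) (θ x).hom (L.mapH g) =
      compH (add_zero n) (K.mapH f) (θ y).hom := by
  constructor
  · rintro rfl
    exact hom_comp_mapH_liftH hL K a θ f
  · intro h
    have h' : compH (zero_add 0) (θ x).inv (θ x).hom = oneH (L.obj (a x)) := (θ x).inv_hom_id
    apply (hL.mapH_bijective _ _ _).1
    rw [mapH_liftH, ← h, ← compH_assoc (zero_add 0) (zero_add n) (zero_add n) (zero_add n),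
      h', oneH_compH]

theorem liftH_oneH (x : B.Obj) : liftH hL K a θ 0 (oneH x) = oneH (a x) := by
  rw [liftH_eq_iff, K.mapH_oneH, L.mapH_oneH, oneH_compH]
  exact compH_oneH _

theorem liftH_compH {x y z : B.Obj} {n m p : ℤ} (h : n + m = p) (f : B.H x y n) (g : B.H y z m) :
    liftH hL K a θ p (compH h f g) = compH h (liftH hL K a θ n f) (liftH hL K a θ m g) := by
  rw [liftH_eq_iff, K.mapH_compH, L.mapH_compH,
    ← compH_assoc (zero_add n) h h (zero_add p), hom_comp_mapH_liftH,
    compH_assoc (add_zero n) (zero_add m) h h, hom_comp_mapH_liftH,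
    compH_assoc h (add_zero m) (add_zero p) h]

/-- A DG functor that takes values in the image of a fully faithful DG functor up to homotopy
equivalence, as a functor between the homotopy categories. -/
noncomputable def liftH0 : H0 B ⥤ H0 A where
  obj x := ⟨a x.obj⟩
  map {x y} f := liftH hL K a θ (x := x.obj) (y := y.obj) 0 f
  map_id x := liftH_oneH hL K a θ x.obj
  map_comp {x y z} f g :=
    liftH_compH hL K a θ (x := x.obj) (y := y.obj) (z := z.obj) (zero_add 0) f g

/-- The functor `liftH0` lifts the given functor. -/
noncomputable def liftH0CompIso : liftH0 hL K a θ ⋙ L.mapH0 ≅ K.mapH0 :=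
  (NatIso.ofComponents (fun x => θ x.obj) (fun f =>
    (hom_comp_mapH_liftH hL K a θ (n := 0) f).symm)).symm

/-- Composition with `liftH0`, with its extension to all degrees. -/
noncomputable def ShiftedFunctor.compLiftH {T : Type uC} [Category.{vC} T] [Preadditive T]
    [HasShift T ℤ] (Ψ : ShiftedFunctor A T) : ShiftedFunctor B T where
  functor := liftH0 hL K a θ ⋙ Ψ.functor
  mapShifted n := (Ψ.mapShifted n).comp (liftH hL K a θ n).toAddMonoidHom
  mapShifted_zero f := Ψ.mapShifted_zero (liftH hL K a θ 0 f)
  mapShifted_comp h f g := by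
    change Ψ.mapShifted _ (liftH hL K a θ _ (compH h f g)) = _
    rw [liftH_compH, Ψ.mapShifted_comp]
    rfl

variable {T : Type uC} [Category.{vC} T]
  [Preadditive T] [HasZeroObject T] [HasShift T ℤ] [∀ n : ℤ, (shiftFunctor T n).Additive]
  [Pretriangulated T]

/-- The lifted triangle is not a priori a cone triangle of `A`. It is compared with the cone `d` of
the lifted morphism: in `P`, the images of `c` and `d` are cones of isomorphic morphisms. -/
theorem _root_.Enhancement.distinguished_compLiftH (ε : Enhancement A T) {x y c : B.Obj}
    (f : B.Z x y 0) (i : B.H y c 0) (p : B.H c x 1) (h : IsConeTriangle f i p) :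
    Triangle.mk ((ε.shiftedFunctor.compLiftH hL K a θ).functor.map (homH0 (cls f)))
      ((ε.shiftedFunctor.compLiftH hL K a θ).functor.map (homH0 i))
      ((ε.shiftedFunctor.compLiftH hL K a θ).mapShifted 1 p) ∈ distTriang T := by
  obtain ⟨f', hf'⟩ := cls_surjective (liftH hL K a θ 0 (cls f))
  obtain ⟨d, i', p', h'⟩ := ε.isPretriangulated.exists_cone f'
  obtain ⟨φ, h₁, h₂⟩ := h.isHomotopyCone.exists_iso_map h'.isHomotopyCone (θ x) (θ y)
    ((liftH_eq_iff hL K a θ _ _).1 hf'.symm)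
  have := hL.full_mapH0
  have := hL.faithful_mapH0
  -- The comparison in `P` descends to `A` because `L` is fully faithful.
  let e : (⟨a c⟩ : H0 A) ≅ ⟨d⟩ := L.mapH0.preimageIso ((θ c).symm ≪≫ φ)
  let q : A.H (a c) d 0 := e.hom
  have hq : IsIso (homH0 q) := inferInstanceAs (IsIso e.hom)
  have he : L.mapH q = compH (zero_add 0) (θ c).inv φ.hom :=
    L.mapH0.map_preimage ((θ c).inv ≫ φ.hom)
  have he' : compH (zero_add 0) (θ c).hom (L.mapH q) = φ.hom := by
    rw [he]
    exact (θ c).hom_inv_id_assoc φ.hom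
  have hd := ε.distinguished_of_isConeTriangle_of_isIso (i := liftH hL K a θ 0 i)
    (p := liftH hL K a θ 1 p) h' q ?_ ?_
  · rw [hf'] at hd
    exact hd
  · apply (hL.mapH_bijective _ _ _).1
    rw [L.mapH_compH, mapH_liftH,
      compH_assoc (zero_add 0) (zero_add 0) (zero_add 0) (zero_add 0),
      compH_assoc (zero_add 0) (zero_add 0) (zero_add 0) (zero_add 0), he', h₁]
    exact (θ y).inv_hom_id_assoc (L.mapH0.map (homH0 i'))
  · refine ((liftH_eq_iff hL K a θ _ _).2 ?_).symm
    rw [L.mapH_compH, ← compH_assoc (zero_add 0) (zero_add 1) (zero_add 1) (zero_add 1), he',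
      h₂]

end DGCat

/-! ### Triangulated subcategories and their enhancements by full DG subcategories. -/

namespace Enhancement

open DGCat

variable {k : Type uk} [CommRing k] {E : DGCat.{uk, u', w'} k} {T : Type u} [Category.{v} T]
  [Preadditive T] [HasZeroObject T] [HasShift T ℤ] [∀ n : ℤ, (shiftFunctor T n).Additive]
  [Pretriangulated T] (Φ : Enhancement E T)

/-- Up to isomorphism, zero objects, shifts and distinguished triangles of `T` come from `E`, so the
closure properties of `IsQ` carry over to `P`. -/
theorem isTriangulated_of_isQ_iff {A : DGCat.{uk, uC, w} k} (hA : A.IsPretriangulated)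
    {G : DGFunctor E A.Perf} (P : ObjectProperty T) [P.IsClosedUnderIsomorphisms]
    (hP : ∀ e, IsQ G e ↔ P (Φ.functor.obj ⟨e⟩)) : P.IsTriangulated := by
  have hP' (X : T) : P X ↔ IsQ G (Φ.functor.objPreimage X).obj := by
    rw [hP]
    exact (P.prop_iff_of_iso (Φ.functor.objObjPreimageIso X)).symm
  have : P.ContainsZero := by
    obtain ⟨z, hz⟩ := Φ.isPretriangulated.exists_zero
    refine ⟨Φ.functor.obj ⟨z⟩, ?_, (hP z).1 (isQ_of_oneH_eq_zero hA hz)⟩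
    rw [IsZero.iff_id_eq_zero, ← Φ.functor.map_id]
    exact (Φ.functor.map_isZero (isZero_of_oneH_eq_zero hz)).eq_of_src _ _
  have : P.IsStableUnderShift ℤ :=
    { isStableUnderShiftBy n :=
        { le_shift X hX := by
            obtain ⟨y, s, t, h₁, h₂⟩ :=
              Φ.isPretriangulated.exists_shift (Φ.functor.objPreimage X).obj n
            have hy : IsQ G y := ((hP' X).1 hX).of_comp_eq hA _ _ s t h₁ h₂
            -- The invertible class `t` identifies the image of `y` with the shift of the image of
            -- the chosen preimage of `X`.
            have := Φ.shiftedFunctor.isIso_mapShifted _ _ t s h₂ h₁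
            exact P.prop_of_iso (asIso (Φ.shiftedFunctor.mapShifted n t) ≪≫
              (shiftFunctor T n).mapIso (Φ.functor.objObjPreimageIso X)) ((hP y).1 hy) } }
  have : P.IsTriangulatedClosed₃ := .mk' (fun S hS h₁ h₂ => by
    obtain ⟨f, hf⟩ := Φ.functor.map_surjective
      ((Φ.functor.objObjPreimageIso S.obj₁).hom ≫ S.mor₁ ≫ (Φ.functor.objObjPreimageIso S.obj₂).inv)
    obtain ⟨f, rfl⟩ := cls_surjective (A := E) f
    obtain ⟨c, i, p, h⟩ := Φ.isPretriangulated.exists_cone f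
    let φ := isoTriangleOfIso₁₂ _ S (Φ.map_distinguished f i p h) hS
      (Φ.functor.objObjPreimageIso S.obj₁) (Φ.functor.objObjPreimageIso S.obj₂) (by
        change Φ.functor.map (cls f) ≫ _ = _
        rw [hf, Category.assoc, Category.assoc, Iso.inv_hom_id]
        exact congrArg _ (Category.comp_id _))
    exact P.prop_of_iso (Triangle.π₃.mapIso φ)
      ((hP c).1 (IsQ.cone hA h.isHomotopyCone ((hP' _).1 h₁) ((hP' _).1 h₂))))
  -- By rotation, closure under the third vertex and under shifts gives closure under the middle
  -- one.
  have : P.IsTriangulatedClosed₂ := .of_isTriangulatedClosed₃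
  constructor

section

variable {S : E.Obj → Prop} {U : Type uC} [Category.{vC} U] (J : U ⥤ T) [J.Full] [J.Faithful]
  (hJ : ∀ e, S e ↔ J.essImage (Φ.functor.obj ⟨e⟩))

/-- The functor from the homotopy category of a full DG subcategory that corresponds to a full
subcategory of an enhanced category. -/
noncomputable def fullFunctor : H0 (E.full S) ⥤ U :=
  Functor.essImage.liftFunctor ((fullInclusion S).mapH0 ⋙ Φ.functor) J
    (fun e => (hJ e.obj.1).1 e.obj.2)

/-- The functor `fullFunctor` is the restriction of the given equivalence. -/
noncomputable def fullFunctorCompIso :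
    Φ.fullFunctor J hJ ⋙ J ≅ (fullInclusion S).mapH0 ⋙ Φ.functor :=
  Functor.essImage.liftFunctorCompIso _ _ _

instance : (fullInclusion S).mapH0.Full := (fullInclusion_isFullyFaithful S).full_mapH0

instance : (fullInclusion S).mapH0.Faithful := (fullInclusion_isFullyFaithful S).faithful_mapH0

theorem isEquivalence_fullFunctor : (Φ.fullFunctor J hJ).IsEquivalence where
  faithful := Functor.Faithful.of_comp_iso (Φ.fullFunctorCompIso J hJ)
  full := Functor.Full.of_comp_faithful_iso (Φ.fullFunctorCompIso J hJ)
  essSurj := ⟨fun X => by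
    let e := Φ.functor.objObjPreimageIso (J.obj X)
    have h : S (Φ.functor.objPreimage (J.obj X)).obj := (hJ _).2 ⟨X, ⟨e.symm⟩⟩
    exact ⟨⟨⟨_, h⟩⟩, ⟨J.preimageIso ((Φ.fullFunctorCompIso J hJ).app ⟨⟨_, h⟩⟩ ≪≫ e)⟩⟩⟩

variable (hS : (E.full S).IsPretriangulated) [Preadditive U] [HasZeroObject U] [HasShift U ℤ]
  [∀ n : ℤ, (shiftFunctor U n).Additive] [Pretriangulated U] [J.CommShift ℤ] [J.IsTriangulated]

/-- A full subcategory of an enhanced category is enhanced by the corresponding full DG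
subcategory. -/
noncomputable def full : Enhancement (E.full S) U :=
  let Ψ := (Φ.shiftedFunctor.precomp (fullInclusion S)).lift J (Φ.fullFunctor J hJ)
    (Φ.fullFunctorCompIso J hJ)
  { isPretriangulated := hS
    functor := Φ.fullFunctor J hJ
    isEquivalence := Φ.isEquivalence_fullFunctor J hJ
    mapShifted := Ψ.mapShifted
    mapShifted_zero := Ψ.mapShifted_zero
    mapShifted_comp := Ψ.mapShifted_comp
    map_distinguished := fun {x y c} f i p h => by
      -- `J` reflects distinguished triangles, and after `J` the triangle is the image under `Φ` of
      -- a cone in `E`.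
      rw [← J.map_distinguished_iff]
      let e := Φ.fullFunctorCompIso J hJ
      refine isomorphic_distinguished _
        (Φ.distinguished_of_isHomotopyCone (h.isHomotopyCone.map (fullInclusion S))) _
        (Triangle.isoMk _ _ (e.app ⟨x⟩) (e.app ⟨y⟩) (e.app ⟨c⟩) ?_ ?_ ?_)
      · exact e.hom.naturality (homH0 (cls f))
      · exact e.hom.naturality (homH0 i)
      · change ShiftedHom.map (Ψ.mapShifted 1 p) J ≫ (e.hom.app ⟨x⟩)⟦(1 : ℤ)⟧' = _
        refine (congrArg (· ≫ _) (ShiftedFunctor.lift_mapShifted_map J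
          (Φ.shiftedFunctor.precomp (fullInclusion S)) _ e 1 p)).trans ?_
        exact (Φ.shiftedFunctor.precomp (fullInclusion S)).ofIso_mapShifted_comp e p }

end

end Enhancement

/-! ### The triangulated structure on the modules and its enhancement. -/

/-- `H^0` is compatible with the composition of DG functors. -/
def DGFunctor.mapH0CompIso {k : Type uk} [CommRing k] {A : DGCat.{uk, uC, vC} k}
    {B : DGCat.{uk, u', w'} k} {D : DGCat.{uk, u, w} k} (F : DGFunctor A B) (G : DGFunctor B D) :
    (F.comp G).mapH0 ≅ F.mapH0 ⋙ G.mapH0 :=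
  NatIso.ofComponents (fun _ => Iso.refl _) (fun {x y} f => by
    obtain ⟨f, rfl⟩ := DGCat.cls_surjective (A := A) f
    exact (Category.comp_id _).trans (Category.id_comp _).symm)

/-- The category of modules over a monad on an enhanced triangulated category, with a triangulated
structure inherited from the modules over the extension to the idempotent completion. -/
theorem DGCat.exists_isTriangulated_algebra
    {k : Type uk} [CommRing k]
    {C : Type uC} [Category.{vC} C] [Preadditive C] [HasZeroObject C] [HasShift C ℤ]
    [∀ n : ℤ, (shiftFunctor C n).Additive] [Pretriangulated C]
    (M : Monad C) [M.toFunctor.Additive]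
    {A : DGCat.{uk, u, w} k} (ε : Enhancement A C)
    [HasZeroObject (karoubiMonad M).Algebra] [HasShift (karoubiMonad M).Algebra ℤ]
    [∀ n : ℤ, (shiftFunctor (karoubiMonad M).Algebra n).Additive]
    [Pretriangulated (karoubiMonad M).Algebra] [IsTriangulated (karoubiMonad M).Algebra]
    {E : DGCat.{uk, u', w'} k} (Φ : Enhancement E (karoubiMonad M).Algebra)
    (G : DGFunctor E A.Perf)
    (hG : G.mapH0 ⋙ toKaroubi (DGCat.H0 A.Perf) ≅
      Φ.functor ⋙ (karoubiMonad M).forget ⋙ ε.karoubiToPerf) :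
    ∃ (_ : HasZeroObject M.Algebra) (_ : HasShift M.Algebra ℤ)
      (_ : ∀ n : ℤ, (shiftFunctor M.Algebra n).Additive)
      (_ : Pretriangulated M.Algebra) (_ : IsTriangulated M.Algebra)
      (_ : M.forget.CommShift ℤ),
      M.forget.IsTriangulated ∧ Nonempty (Enhancement G.Q M.Algebra) := by
  let J := karoubiAlgebra M
  have hJ := ε.isQ_iff G Φ.functor hG
  have := Φ.isTriangulated_of_isQ_iff ε.isPretriangulated J.essImage hJ
  obtain ⟨_, _, _, _, _, _⟩ := J.exists_pretriangulated_of_fullyFaithful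
  -- The octahedral axiom is inherited along the fully faithful exact functor `J`.
  have := IsTriangulated.of_fully_faithful_triangulated_functor J
  let Θ : Enhancement G.Q M.Algebra :=
    Φ.full J hJ (DGCat.isPretriangulated_Q ε.isPretriangulated Φ.isPretriangulated)
  let I := DGCat.fullInclusion (IsQ G)
  -- Membership in `G.Q` only asserts existence; choosing the objects of `A` and the equivalences
  -- turns `G` into a functor to `H0 A`.
  choose a θ using fun e : G.Q.Obj => e.2
  replace θ := fun e => (θ e).some
  let Ψ := ε.shiftedFunctor.compLiftH A.toPerf_isFullyFaithful (I.comp G) a θ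
  let i : I.mapH0 ⋙ G.mapH0 ≅ liftH0 A.toPerf_isFullyFaithful (I.comp G) a θ ⋙ A.toPerf.mapH0 :=
    (I.mapH0CompIso G).symm ≪≫ (liftH0CompIso A.toPerf_isFullyFaithful (I.comp G) a θ).symm
  -- Both functors take values in `C`, which embeds fully faithfully in the idempotent completion of
  -- `H0 A.Perf`; there each becomes `G` restricted to `G.Q`.
  let e : Θ.functor ⋙ M.forget ≅ Ψ.functor :=
    Functor.fullyFaithfulCancelRight (toKaroubi C ⋙ ε.karoubiToPerf)
      (Functor.isoWhiskerRight (Φ.fullFunctorCompIso J hJ)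
          ((karoubiMonad M).forget ⋙ ε.karoubiToPerf) ≪≫
        Functor.isoWhiskerLeft I.mapH0 hG.symm ≪≫
        Functor.isoWhiskerRight i (toKaroubi _) ≪≫
        Functor.isoWhiskerLeft (liftH0 A.toPerf_isFullyFaithful (I.comp G) a θ)
          ε.functorCompKaroubiToPerf.symm)
  obtain ⟨_, _⟩ := Θ.exists_commShift_isTriangulated Ψ
    (fun f i p h => ε.distinguished_compLiftH A.toPerf_isFullyFaithful (I.comp G) a θ f i p h)
    M.forget e
  exact ⟨inferInstance, inferInstance, inferInstance, inferInstance, inferInstance, inferInstance,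
    inferInstance, ⟨Θ⟩⟩

/-- Let `M` be an exact monad on a triangulated category `C`, let `A` be an enhancement of `C`, let
`MA` be a DG monad on `A` lifting `M`, and let `N` be a DG monad on `Perf (A)` lifting `MA`. Suppose
that the category of modules over the extension of `M` to the idempotent completion of `C` is
triangulated and has an enhancement `E` with a DG adjunction `F ⊣ G` between `Perf (A)` and `E` such
that `G ∘ F` is `N`, and such that `G` corresponds to the forgetful functor of that category of
modules. Then the category of `M`-modules has a triangulated structure for which the free module
functor and the forgetful functor are exact, and with this structure it is enhanced by the full DG
subcategory `G.Q` of `E`. -/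
theorem mainTheorem3
    {k : Type uk} [CommRing k]
    {C : Type uC} [Category.{vC} C] [Preadditive C] [HasZeroObject C] [HasShift C ℤ]
    [∀ n : ℤ, (shiftFunctor C n).Additive] [Pretriangulated C] [IsTriangulated C]
    (M : Monad C) [M.toFunctor.CommShift ℤ] [M.toFunctor.IsTriangulated]
    (A : DGCat.{uk, u, w} k) (ε : Enhancement A C)
    (MA : DGMonad A)
    (hMA : Nonempty (MA.functor.mapH0 ⋙ ε.functor ≅ ε.functor ⋙ M.toFunctor))
    (N : DGMonad A.Perf)
    (hN : Nonempty (DGNatIso (A.toPerf.comp N.functor) (MA.functor.comp A.toPerf)))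
    [HasZeroObject (karoubiMonad M).Algebra] [HasShift (karoubiMonad M).Algebra ℤ]
    [∀ n : ℤ, (shiftFunctor (karoubiMonad M).Algebra n).Additive]
    [Pretriangulated (karoubiMonad M).Algebra] [IsTriangulated (karoubiMonad M).Algebra]
    (E : DGCat.{uk, u', w'} k) (Φ : Enhancement E (karoubiMonad M).Algebra)
    (F : DGFunctor A.Perf E) (G : DGFunctor E A.Perf) (adj : DGAdjunction F G)
    (hGF : Nonempty (DGNatIso (F.comp G) N.functor))
    (hG : Nonempty (G.mapH0 ⋙ toKaroubi (DGCat.H0 A.Perf) ≅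
      Φ.functor ⋙ (karoubiMonad M).forget ⋙ ε.karoubiToPerf)) :
    ∃ (_ : HasZeroObject M.Algebra) (_ : HasShift M.Algebra ℤ)
      (_ : ∀ n : ℤ, (shiftFunctor M.Algebra n).Additive)
      (_ : Pretriangulated M.Algebra) (_ : IsTriangulated M.Algebra)
      (_ : M.free.CommShift ℤ) (_ : M.forget.CommShift ℤ),
      M.free.IsTriangulated ∧ M.forget.IsTriangulated ∧ Nonempty (Enhancement G.Q M.Algebra) := by

  obtain ⟨_, _, _, _, _, _, _, hE⟩ := DGCat.exists_isTriangulated_algebra M ε Φ G hG.some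
  -- The free functor receives its compatibility with shifts from the forgetful functor through the
  -- adjunction, and a left adjoint of an exact functor is exact for it.
  let := M.adj.leftAdjointCommShift ℤ
  have := M.adj.commShift_of_rightAdjoint ℤ
  exact ⟨inferInstance, inferInstance, inferInstance, inferInstance, inferInstance, inferInstance,
    inferInstance, M.adj.isTriangulated_leftAdjoint, inferInstance, hE⟩
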